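/- Let $G$ be a locally compact (Hausdorff) group with left Haar measure $dg$ and modular function $\Delta$, normalized by $\Delta(h)\int_G f(gh)\,dg=\int_G f(g)\,dg$. A *twist* for $G$ is a central extension of locally compact Hausdorff groups $1\to\mathbb T\xrightarrow{\iota}\tilde G\xrightarrow{q}G\to1$ (so $\iota$ is a homeomorphism onto its image and $q$ is open and continuous). Two twists are equivalent if there is an isomorphism of topological groups between them inducing the identity on $G$ and on $\mathbb T$; $\mathrm{Twist}(G)$ is the set of equivalence classes $[\tilde G]$. An *action* of $G$ on compact operators is a homomorphism $\alpha:G\to\mathrm{Aut}(\mathcal K(\mathcal H))$, with $\mathcal H$ a nonzero Hilbert space, such that $g\mapsto\alpha_g(T)$ is norm continuous for every $T\in\mathcal K(\mathcal H)$. Two actions $\alpha:G\curvearrowright\mathcal K(\mathcal H_\alpha)$ and $\beta:G\curvearrowright\mathcal K(\mathcal H_\beta)$ are *Morita equivalent* if there are a $\mathcal K(\mathcal H_\alpha)$-$\mathcal K(\mathcal H_\beta)$ equivalence (imprimitivity) bimodule $\mathcal X$ and a strongly continuous action $\gamma$ of $G$ on $\mathcal X$ by linear bijections which is compatible, via $\alpha$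 and $\beta$, with the left and right module structures and inner products. For a twist $\tilde G$ let $L^2(\tilde G,\iota)$ be the completion of $C_c(\tilde G,\iota)=\{f\in C_c(\tilde G): f(\tilde g\,\iota(z))=zf(\tilde g)\ \forall \tilde g\in\tilde G,\ z\in\mathbb T\}$ for the inner product $\langle\xi,\eta\rangle=\int_G\overline{\xi(\tilde g)}\,\eta(\tilde g)\,dg$, $g=q(\tilde g)$, and let $\tilde\rho:\tilde G\to\mathcal U(L^2(\tilde G,\iota))$ be the unitary representation with $(\tilde\rho(\tilde g)\xi)(\tilde s)=\sqrt{\Delta(g)}\,\xi(\tilde s\tilde g)$ for $\xi\in C_c(\tilde G,\iota)$. Let $\tilde\alpha:G\to\mathrm{Aut}(\mathcal K(L^2(\tilde G,\iota)))$ be the homomorphism with $\tilde\alpha_{q(\tilde g)}=\mathrm{Ad}\,\tilde\rho(\tilde g)$. For an action $\alpha:G\curvearrowright\mathcal K(\mathcal H)$ let $$G_\alpha=\{(g,v)\in G\times\mathcal U(\mathcal H):\alpha_g=\mathrm{Ad}\,v\},$$ with the topology inherited from $G\times\mathcal U(\mathcal H)$, where $\mathcal U(\mathcal H)$ carries the strong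 operator topology, and with the maps $\iota_\alpha(z)=(e,z1_{\mathcal H})$ and $q_\alpha(g,v)=g$. **Proposition.** Morita equivalence is an equivalence relation on the actions of $G$ on compact operators; let $\mathrm{Br}(G)$ be its set of classes $[\alpha]$. For every twist $\tilde G$ the homomorphism $\tilde\alpha$ is an action of $G$ on compact operators, and for every action $\alpha$ of $G$ on compact operators $1\to\mathbb T\xrightarrow{\iota_\alpha}G_\alpha\xrightarrow{q_\alpha}G\to1$ is a twist for $G$. The assignment $[\tilde G]\mapsto[\tilde\alpha]$ is well defined and is a bijection $\mathrm{Twist}(G)\to\mathrm{Br}(G)$. Its inverse is well defined and given by $[\alpha]\mapsto[G_\alpha]$. -/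

import Mathlib

open MeasureTheory
open scoped ComplexConjugate

universe u

set_option linter.unusedSectionVars false

namespace GroupTwist

/-! ## Compact operators on a Hilbert space and their automorphisms -/

section CompactOperators

variable {H : Type u} [NormedAddCommGroup H] [InnerProductSpace ℂ H] [CompleteSpace H]

/-- The adjoint of a compact operator on a Hilbert space is compact. -/
theorem isCompactOperator_adjoint {T : H →L[ℂ] H} (hT : IsCompactOperator T) :
    IsCompactOperator (ContinuousLinearMap.adjoint T) := by
  set S := ContinuousLinearMap.adjoint T with hS
  have hTS : IsCompactOperator (T ∘L S) := hT.comp_clm S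
  have key : ∀ x : H, ‖S x‖ ^ 2 ≤ ‖x‖ * ‖T (S x)‖ := by
    intro x
    have h1 : inner ℂ (S x) (S x) = inner ℂ x (T (S x)) :=
      ContinuousLinearMap.adjoint_inner_left T (S x) x
    have h2 : ‖inner ℂ (S x) (S x)‖ = ‖S x‖ ^ 2 := by
      rw [inner_self_eq_norm_sq_to_K]; simp
    rw [← h2, h1]
    exact norm_inner_le_norm _ _
  have hTB' : TotallyBounded ((T ∘L S : H → H) '' Metric.closedBall 0 1) :=
    (IsCompactOperator.isCompact_closure_image_closedBall
      (f := ((T ∘L S : H →L[ℂ] H) : H →ₗ[ℂ] H)) hTS 1).totallyBounded.subset subset_closure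
  have hTB : TotallyBounded ((S : H → H) '' Metric.closedBall 0 1) := by
    refine Metric.totallyBounded_of_finite_discretization fun ε hε => ?_
    obtain ⟨t, ht, hcov⟩ := Metric.totallyBounded_iff.1 hTB' (ε ^ 2 / 8) (by positivity)
    have hx : ∀ y : (S : H → H) '' Metric.closedBall 0 1,
        ∃ x : H, ‖x‖ ≤ 1 ∧ S x = y ∧ ∃ c : t, ‖T (S x) - c‖ < ε ^ 2 / 8 := by
      rintro ⟨_, x, hx, rfl⟩
      have hm := hcov (Set.mem_image_of_mem _ hx)
      simp only [Set.mem_iUnion] at hm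
      obtain ⟨c, hc, hxc⟩ := hm
      exact ⟨x, by simpa using hx, rfl, ⟨c, hc⟩, by simpa [dist_eq_norm] using hxc⟩
    choose x hx1 hx2 c hc using hx
    refine ⟨t, ht.fintype, c, fun y z hyz => ?_⟩
    have hb : ‖x y - x z‖ ≤ 2 := (norm_sub_le _ _).trans (by linarith [hx1 y, hx1 z])
    have hd : ‖T (S (x y - x z))‖ ≤ ε ^ 2 / 4 := by
      have e : T (S (x y - x z)) = (T (S (x y)) - c y) - (T (S (x z)) - c z) := by
        rw [hyz]; simp
      rw [e]
      exact (norm_sub_le _ _).trans (by linarith [hc y, hc z])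
    have hk := key (x y - x z)
    have : ‖S (x y - x z)‖ ^ 2 < ε ^ 2 := by
      have := mul_le_mul hb hd (norm_nonneg _) (by norm_num)
      have : 0 < ε ^ 2 := by positivity
      linarith
    rw [dist_eq_norm, ← hx2 y, ← hx2 z, ← map_sub]
    exact lt_of_pow_lt_pow_left₀ 2 hε.le this
  change IsCompactOperator (S : H →ₗ[ℂ] H)
  rw [isCompactOperator_iff_isCompact_closure_image_closedBall (S : H →ₗ[ℂ] H) zero_lt_one]
  exact hTB.closure.isCompact_of_isClosed isClosed_closure

variable (H) in
/-- The C⋆-algebra `𝒦(H)` of compact operators on a Hilbert space `H`. -/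
noncomputable def compactOps : NonUnitalStarSubalgebra ℂ (H →L[ℂ] H) where
  carrier := {T | IsCompactOperator T}
  add_mem' hS hT := hS.add hT
  zero_mem' := isCompactOperator_zero
  mul_mem' {S T} hS _ := IsCompactOperator.comp_clm (f := S) hS T
  smul_mem' c _ hT := hT.smul c
  star_mem' hT := isCompactOperator_adjoint hT

instance : IsClosed (compactOps H : Set (H →L[ℂ] H)) :=
  isClosed_setOfPred_isCompactOperator

/-- The group of automorphisms of the C⋆-algebra `𝒦(H)` (with composition as product). -/
noncomputable instance : Group (compactOps H ≃⋆ₐ[ℂ] compactOps H) := StarAlgEquiv.aut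

variable (H) in
/-- The homomorphism `Ad : 𝒰(H) → Aut 𝒦(H)`, `Ad v (T) = v T v*`, on the unitary group
of `H` (the group of surjective linear isometries of `H`). -/
noncomputable def Ad : (H ≃ₗᵢ[ℂ] H) →* (compactOps H ≃⋆ₐ[ℂ] compactOps H) where
  toFun v :=
    { toFun := fun T => ⟨v.conjStarAlgEquiv (T : H →L[ℂ] H),
        (T.2.comp_clm (v.symm : H →L[ℂ] H)).clm_comp (v : H →L[ℂ] H)⟩
      invFun := fun T => ⟨v.symm.conjStarAlgEquiv (T : H →L[ℂ] H),
        (T.2.comp_clm (v : H →L[ℂ] H)).clm_comp (v.symm : H →L[ℂ] H)⟩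
      left_inv := fun T => Subtype.ext (v.conjStarAlgEquiv.symm_apply_apply (T : H →L[ℂ] H))
      right_inv := fun T => Subtype.ext (v.conjStarAlgEquiv.apply_symm_apply (T : H →L[ℂ] H))
      map_mul' := fun S T => Subtype.ext (map_mul v.conjStarAlgEquiv (S : H →L[ℂ] H) T)
      map_add' := fun S T => Subtype.ext (map_add v.conjStarAlgEquiv (S : H →L[ℂ] H) T)
      map_star' := fun T => Subtype.ext (map_star v.conjStarAlgEquiv (T : H →L[ℂ] H))
      map_smul' := fun c T => Subtype.ext (map_smul v.conjStarAlgEquiv c (T : H →L[ℂ] H)) }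
  map_one' := by ext; rfl
  map_mul' v w := by ext; rfl

theorem coe_Ad_apply (v : H ≃ₗᵢ[ℂ] H) (T : compactOps H) (x : H) :
    (Ad H v T : H →L[ℂ] H) x = v ((T : H →L[ℂ] H) (v.symm x)) := rfl

variable (H) in
/-- Multiplication by a scalar of modulus one, as a unitary on `H`. -/
noncomputable def scalarUnitary : Circle →* (H ≃ₗᵢ[ℂ] H) where
  toFun z :=
    { toLinearEquiv := LinearEquiv.smulOfNeZero ℂ H (z : ℂ) z.coe_ne_zero
      norm_map' := fun x => by
        change ‖(z : ℂ) • x‖ = ‖x‖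
        rw [norm_smul, Circle.norm_coe, one_mul] }
  map_one' := by ext x; simp
  map_mul' z w := by
    ext x
    change ((z * w : Circle) : ℂ) • x = (z : ℂ) • (w : ℂ) • x
    rw [Circle.coe_mul, mul_smul]

theorem scalarUnitary_apply (z : Circle) (x : H) : scalarUnitary H z x = (z : ℂ) • x := rfl

theorem Ad_scalarUnitary (z : Circle) : Ad H (scalarUnitary H z) = 1 := by
  ext T x
  rw [coe_Ad_apply, scalarUnitary_apply, ← map_smul, ← scalarUnitary_apply,
    LinearIsometryEquiv.apply_symm_apply]
  rfl

end CompactOperators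

/-! ## Twists -/

section Twists

variable (G : Type u) [Group G] [TopologicalSpace G]

/-- A sequence of homomorphisms `𝕋 → E → G`, where `E` is a group with a topology. -/
structure CircleSequence where
  carrier : Type u
  [group : Group carrier]
  [topology : TopologicalSpace carrier]
  ι : Circle →* carrier
  q : carrier →* G

attribute [instance] CircleSequence.group CircleSequence.topology

variable {G}

/-- The sequence `1 → 𝕋 → E → G → 1` is a central extension of locally compact (Hausdorff)
groups: it is exact, `𝕋` is central in `E`, `ι` is a homeomorphism onto its image and `q` induces
a homeomorphism `E / ι(𝕋) ≅ G`. -/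
structure CircleSequence.IsTwist (E : CircleSequence G) : Prop where
  isTopologicalGroup : IsTopologicalGroup E.carrier
  locallyCompactSpace : LocallyCompactSpace E.carrier
  t2Space : T2Space E.carrier
  isEmbedding_ι : Topology.IsEmbedding E.ι
  isOpenQuotientMap_q : IsOpenQuotientMap E.q
  ker_q : E.q.ker = E.ι.range
  central : ∀ z : Circle, E.ι z ∈ Subgroup.center E.carrier

variable (G) in
/-- A twist for `G`: a central extension of locally compact groups of `G` by `𝕋`. -/
structure Twist extends CircleSequence G where
  isTwist : toCircleSequence.IsTwist

/-- Two twists are equivalent if there is an isomorphism of topological groups between them that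
induces the identity maps on `G` and on `𝕋`. -/
def Twist.Equivalent (E F : Twist G) : Prop :=
  ∃ φ : E.carrier ≃ₜ* F.carrier, (∀ z, φ (E.ι z) = F.ι z) ∧ ∀ x, F.q (φ x) = E.q x

instance Twist.setoid : Setoid (Twist G) where
  r := Twist.Equivalent
  iseqv :=
    { refl := fun E => ⟨ContinuousMulEquiv.refl _, fun _ => rfl, fun _ => rfl⟩
      symm := by
        rintro E F ⟨φ, h1, h2⟩
        refine ⟨φ.symm, fun z => ?_, fun x => ?_⟩
        · rw [← h1, ContinuousMulEquiv.symm_apply_apply]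
        · rw [← h2, ContinuousMulEquiv.apply_symm_apply]
      trans := by
        rintro E F K ⟨φ, h1, h2⟩ ⟨ψ, h3, h4⟩
        exact ⟨φ.trans ψ, fun z => by simp [h1, h3], fun x => by simp [h2, h4]⟩ }

variable (G) in
/-- The set `Twist(G)` of equivalence classes of twists for `G`. -/
def TwistClass : Type (u + 1) := Quotient (Twist.setoid (G := G))

/-- The class of a twist in `Twist(G)`. -/
def TwistClass.mk (E : Twist G) : TwistClass G := Quotient.mk _ E

end Twists

/-! ## Equivariant Morita equivalence -/

section Morita

/-- An `A`-`B` equivalence (imprimitivity) bimodule structure on the Banach space `X`, for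
C⋆-algebras `A` and `B`: `X` is a full left Hilbert `A`-module and a full right Hilbert `B`-module,
the two norms agree with the norm of `X`, the two actions commute and are adjointable, and
`⟨x, y⟩_A · z = x · ⟨y, z⟩_B`. Here `lsmul a x` is `a · x` and `rsmul b x` is `x · b`.
Positivity of an element of a C⋆-algebra is expressed as being of the form `c* c`. -/
structure EquivalenceBimodule (A B X : Type*) [NonUnitalCStarAlgebra A] [NonUnitalCStarAlgebra B]
    [NormedAddCommGroup X] [NormedSpace ℂ X] [CompleteSpace X] where
  lsmul : A →ₗ[ℂ] X →ₗ[ℂ] X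
  rsmul : B →ₗ[ℂ] X →ₗ[ℂ] X
  linner : X →ₗ[ℂ] X →ₗ⋆[ℂ] A
  rinner : X →ₗ⋆[ℂ] X →ₗ[ℂ] B
  mul_lsmul : ∀ a a' x, lsmul (a * a') x = lsmul a (lsmul a' x)
  mul_rsmul : ∀ b b' x, rsmul (b * b') x = rsmul b' (rsmul b x)
  lsmul_rsmul : ∀ a b x, lsmul a (rsmul b x) = rsmul b (lsmul a x)
  star_linner : ∀ x y, star (linner x y) = linner y x
  star_rinner : ∀ x y, star (rinner x y) = rinner y x
  linner_lsmul : ∀ a x y, linner (lsmul a x) y = a * linner x y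
  rinner_rsmul : ∀ x y b, rinner x (rsmul b y) = rinner x y * b
  linner_self_nonneg : ∀ x, ∃ c, linner x x = star c * c
  rinner_self_nonneg : ∀ x, ∃ c, rinner x x = star c * c
  norm_linner_self : ∀ x, ‖linner x x‖ = ‖x‖ ^ 2
  norm_rinner_self : ∀ x, ‖rinner x x‖ = ‖x‖ ^ 2
  rinner_lsmul : ∀ a x y, rinner (lsmul a x) y = rinner x (lsmul (star a) y)
  linner_rsmul : ∀ b x y, linner (rsmul b x) y = linner x (rsmul (star b) y)
  linner_lsmul_eq_rinner_rsmul : ∀ x y z, lsmul (linner x y) z = rsmul (rinner y z) x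
  left_full : Dense (Submodule.span ℂ {a : A | ∃ x y, linner x y = a} : Set A)
  right_full : Dense (Submodule.span ℂ {b : B | ∃ x y, rinner x y = b} : Set B)

variable (G : Type u) [Group G] [TopologicalSpace G]

/-- A homomorphism `α : G → Aut 𝒦(H)`, where `H` is a Hilbert space. -/
structure CompactHom where
  H : Type u
  [normedAddCommGroup : NormedAddCommGroup H]
  [innerProductSpace : InnerProductSpace ℂ H]
  [completeSpace : CompleteSpace H]
  α : G →* (compactOps H ≃⋆ₐ[ℂ] compactOps H)

attribute [instance] CompactHom.normedAddCommGroup CompactHom.innerProductSpace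
  CompactHom.completeSpace

variable {G}

/-- `α : G → Aut 𝒦(H)` is an action on the compact operators: `H` is nonzero and `α` is strongly
continuous. -/
structure CompactHom.IsAction (a : CompactHom G) : Prop where
  nontrivial : Nontrivial a.H
  continuous : ∀ T : compactOps a.H, Continuous fun g : G => a.α g T

variable (G) in
/-- An action of `G` on the algebra of compact operators on some nonzero Hilbert space. -/
structure CompactAction extends CompactHom G where
  isAction : toCompactHom.IsAction

/-- Two actions `α`, `β` of `G` on compact operators are (equivariantly) Morita equivalent if
there are an equivalence bimodule `X` and a strongly continuous action `γ` of `G` on `X`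
compatible with `α` and `β` in the module actions and in the inner products. -/
def MoritaEquivalent (a b : CompactAction G) : Prop :=
  ∃ (X : Type u) (_ : NormedAddCommGroup X) (_ : NormedSpace ℂ X) (_ : CompleteSpace X)
    (M : EquivalenceBimodule (compactOps a.H) (compactOps b.H) X) (γ : G →* (X ≃ₗ[ℂ] X)),
    (∀ x, Continuous fun g : G => γ g x) ∧
    (∀ g T x, γ g (M.lsmul T x) = M.lsmul (a.α g T) (γ g x)) ∧
    (∀ g T x, γ g (M.rsmul T x) = M.rsmul (b.α g T) (γ g x)) ∧
    (∀ g x y, M.linner (γ g x) (γ g y) = a.α g (M.linner x y)) ∧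
    (∀ g x y, M.rinner (γ g x) (γ g y) = b.α g (M.rinner x y))

variable (G) in
/-- The set `Br(G)` of Morita equivalence classes of actions of `G` on compact operators. -/
def BrauerClass : Type (u + 1) := Quot (MoritaEquivalent (G := G))

/-- The class of an action in `Br(G)`. -/
def BrauerClass.mk (a : CompactAction G) : BrauerClass G := Quot.mk _ a

end Morita

/-! ## The extension associated with an action on compact operators -/

section Extension

variable {G : Type u} [Group G] [TopologicalSpace G]

/-- The group `G_α = {(g, v) ∈ G × 𝒰(H) : α_g = Ad v}`. -/
noncomputable def CompactHom.extensionGroup (a : CompactHom G) : Subgroup (G × (a.H ≃ₗᵢ[ℂ] a.H)) :=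
  (a.α.comp (MonoidHom.fst G (a.H ≃ₗᵢ[ℂ] a.H))).eqLocus
    ((Ad a.H).comp (MonoidHom.snd G (a.H ≃ₗᵢ[ℂ] a.H)))

theorem CompactHom.mem_extensionGroup (a : CompactHom G) (p : G × (a.H ≃ₗᵢ[ℂ] a.H)) :
    p ∈ a.extensionGroup ↔ a.α p.1 = Ad a.H p.2 := Iff.rfl

/-- The sequence `𝕋 → G_α → G`, with maps `z ↦ (1, z·1)` and `(g, v) ↦ g`. The topology of `G_α`
is induced by the product topology of `G × 𝒰(H)`, where `𝒰(H)` carries the strong operator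
topology, i.e. the topology of pointwise convergence. -/
noncomputable def CompactHom.extension (a : CompactHom G) : CircleSequence G where
  carrier := a.extensionGroup
  topology := TopologicalSpace.induced
    (fun p => (p.1.1, (p.1.2 : a.H → a.H)) : a.extensionGroup → G × (a.H → a.H)) inferInstance
  ι :=
    { toFun := fun z => ⟨(1, scalarUnitary a.H z), by
        rw [CompactHom.mem_extensionGroup, Ad_scalarUnitary]
        exact a.α.map_one⟩
      map_one' := Subtype.ext (Prod.ext rfl (map_one (scalarUnitary a.H)))
      map_mul' := fun z w => Subtype.ext
        (Prod.ext (one_mul 1).symm (map_mul (scalarUnitary a.H) z w)) }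
  q := (MonoidHom.fst _ _).comp a.extensionGroup.subtype

/-- If `ρ : E → 𝒰(H)` is a unitary representation of a twist such that `ρ(ι(z))` is multiplication
by `z`, then `Ad ρ` factors through a homomorphism `G → Aut 𝒦(H)`. -/
noncomputable def Twist.descendAd (E : Twist G) {H : Type u} [NormedAddCommGroup H]
    [InnerProductSpace ℂ H] [CompleteSpace H] (ρ : E.carrier →* (H ≃ₗᵢ[ℂ] H))
    (hρ : ∀ z, ρ (E.ι z) = scalarUnitary H z) : G →* (compactOps H ≃⋆ₐ[ℂ] compactOps H) :=
  E.q.liftOfSurjective E.isTwist.isOpenQuotientMap_q.surjective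
    ⟨(Ad H).comp ρ, by
      rw [E.isTwist.ker_q]
      rintro _ ⟨z, rfl⟩
      change Ad H (ρ (E.ι z)) = 1
      rw [hρ, Ad_scalarUnitary]⟩

theorem Twist.descendAd_q (E : Twist G) {H : Type u} [NormedAddCommGroup H]
    [InnerProductSpace ℂ H] [CompleteSpace H] (ρ : E.carrier →* (H ≃ₗᵢ[ℂ] H))
    (hρ : ∀ z, ρ (E.ι z) = scalarUnitary H z) (y : E.carrier) :
    E.descendAd ρ hρ (E.q y) = Ad H (ρ y) :=
  MonoidHom.liftOfRightInverse_comp_apply _ _ _ _ y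

end Extension

/-! ## The action associated with a twist -/

section RegularAction

variable {G : Type u} [Group G] [TopologicalSpace G]

/-- The space `C_c(E, ι)` of continuous compactly supported functions `f` on `E` with
`f (x ι(z)) = z f(x)`, as a subspace of the space of all functions. -/
def Twist.ccSubmodule (E : Twist G) : Submodule ℂ (E.carrier → ℂ) where
  carrier := {f | Continuous f ∧ HasCompactSupport f ∧ ∀ x z, f (x * E.ι z) = z * f x}
  add_mem' := fun ⟨h1, h2, h3⟩ ⟨k1, k2, k3⟩ =>
    ⟨h1.add k1, h2.add k2, fun x z => by simp [h3, k3, mul_add]⟩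
  zero_mem' := ⟨continuous_zero, HasCompactSupport.zero, by simp⟩
  smul_mem' c _ := fun ⟨h1, h2, h3⟩ =>
    ⟨continuous_const.mul h1, h2.mul_left, fun x z => by simp [h3]; ring⟩

/-- `C_c(E, ι)` as a type of its own, on which the Haar measure `μ` of `G` determines the inner
product below. -/
def TwistedCc [MeasurableSpace G] (_μ : Measure G) (E : Twist G) : Type u := E.ccSubmodule

namespace TwistedCc

variable [MeasurableSpace G] {μ : Measure G} {E : Twist G}

noncomputable instance : AddCommGroup (TwistedCc μ E) :=
  inferInstanceAs (AddCommGroup E.ccSubmodule)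

noncomputable instance : Module ℂ (TwistedCc μ E) :=
  inferInstanceAs (Module ℂ E.ccSubmodule)

instance : CoeFun (TwistedCc μ E) fun _ => E.carrier → ℂ := ⟨fun ξ => ξ.1⟩

variable (E) in
/-- Some (not necessarily continuous) section of `q`. -/
noncomputable def sec (g : G) : E.carrier :=
  Function.surjInv E.isTwist.isOpenQuotientMap_q.surjective g

theorem q_sec (g : G) : E.q (sec E g) = g :=
  Function.surjInv_eq E.isTwist.isOpenQuotientMap_q.surjective g

theorem continuous_coe (ξ : TwistedCc μ E) : Continuous ξ := ξ.2.1

theorem hasCompactSupport_coe (ξ : TwistedCc μ E) : HasCompactSupport ξ := ξ.2.2.1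

theorem apply_mul_ι (ξ : TwistedCc μ E) (x : E.carrier) (z : Circle) :
    ξ (x * E.ι z) = z * ξ x := ξ.2.2.2 x z

theorem exists_of_q_eq {x y : E.carrier} (h : E.q x = E.q y) : ∃ z, y = x * E.ι z := by
  have : x⁻¹ * y ∈ E.q.ker := by simp [MonoidHom.mem_ker, h]
  rw [E.isTwist.ker_q] at this
  obtain ⟨z, hz⟩ := this
  exact ⟨z, by simp [hz]⟩

/-- The function on `G` with value `conj (ξ x) * η x` at `g = q x`; it does not depend on the
choice of `x`. -/
noncomputable def pairing (ξ η : TwistedCc μ E) (g : G) : ℂ :=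
  conj (ξ (sec E g)) * η (sec E g)

theorem pairing_q (ξ η : TwistedCc μ E) (x : E.carrier) :
    pairing ξ η (E.q x) = conj (ξ x) * η x := by
  obtain ⟨z, hz⟩ := exists_of_q_eq (q_sec (E.q x)).symm
  have hz1 : conj (z : ℂ) * z = 1 := by
    rw [mul_comm, Complex.mul_conj, Circle.normSq_coe]; simp
  rw [pairing, hz, apply_mul_ι, apply_mul_ι, map_mul]
  linear_combination (conj (ξ x) * η x) * hz1

theorem continuous_pairing (ξ η : TwistedCc μ E) : Continuous (pairing ξ η) := by
  rw [E.isTwist.isOpenQuotientMap_q.isQuotientMap.continuous_iff]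
  have : pairing ξ η ∘ E.q = fun x => conj (ξ x) * η x := funext (pairing_q ξ η)
  rw [this]
  exact (Complex.continuous_conj.comp ξ.continuous_coe).mul η.continuous_coe

variable [T2Space G]

theorem hasCompactSupport_pairing (ξ η : TwistedCc μ E) : HasCompactSupport (pairing ξ η) := by
  have hK : IsCompact (E.q '' tsupport η) :=
    η.hasCompactSupport_coe.isCompact.image E.isTwist.isOpenQuotientMap_q.continuous
  refine HasCompactSupport.intro hK fun g hg => ?_
  have : η (sec E g) = 0 := by
    by_contra h
    exact hg ⟨sec E g, subset_tsupport _ h, q_sec g⟩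
  simp [pairing, this]

variable [BorelSpace G] [IsFiniteMeasureOnCompacts μ]

theorem integrable_pairing (ξ η : TwistedCc μ E) : Integrable (pairing ξ η) μ :=
  (continuous_pairing ξ η).integrable_of_hasCompactSupport (hasCompactSupport_pairing ξ η)

/-- The inner product `⟨ξ, η⟩ = ∫_G conj (ξ x) * η x dg`, with `g = q x`. -/
noncomputable instance core : PreInnerProductSpace.Core ℂ (TwistedCc μ E) where
  inner ξ η := ∫ g, pairing ξ η g ∂μ
  conj_inner_symm ξ η := by
    rw [← integral_conj]
    congr 1
    ext g
    simp [pairing, mul_comm]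
  re_inner_nonneg ξ := by
    have : ∀ g, pairing ξ ξ g = ((‖ξ (sec E g)‖ ^ 2 : ℝ) : ℂ) := fun g => by
      simp [pairing, mul_comm, Complex.mul_conj, Complex.normSq_eq_norm_sq]
    simp only [this]
    rw [integral_complex_ofReal]
    exact integral_nonneg fun g => sq_nonneg _
  add_left ξ ξ' η := by
    rw [← integral_add (integrable_pairing ξ η) (integrable_pairing ξ' η)]
    congr 1
    ext g
    change conj (ξ (sec E g) + ξ' (sec E g)) * η (sec E g) = _
    simp [pairing, add_mul]
  smul_left ξ η c := by
    rw [← integral_const_mul]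
    congr 1
    ext g
    change conj (c * ξ (sec E g)) * η (sec E g) = _
    simp [pairing, mul_assoc]

noncomputable instance : SeminormedAddCommGroup (TwistedCc μ E) :=
  InnerProductSpace.Core.toSeminormedAddCommGroup (𝕜 := ℂ)

noncomputable instance : InnerProductSpace ℂ (TwistedCc μ E) :=
  InnerProductSpace.ofCore core

theorem inner_def (ξ η : TwistedCc μ E) : inner ℂ ξ η = ∫ g, pairing ξ η g ∂μ := rfl

theorem norm_sq (ξ : TwistedCc μ E) : ‖ξ‖ ^ 2 = ∫ g, ‖ξ (sec E g)‖ ^ 2 ∂μ := by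
  have : ∀ g, pairing ξ ξ g = ((‖ξ (sec E g)‖ ^ 2 : ℝ) : ℂ) := fun g => by
    simp [pairing, mul_comm, Complex.mul_conj, Complex.normSq_eq_norm_sq]
  rw [← inner_self_eq_norm_sq (𝕜 := ℂ), inner_def]
  simp only [this]
  rw [integral_complex_ofReal]
  simp

end TwistedCc

variable [IsTopologicalGroup G] [LocallyCompactSpace G] [T2Space G]

/-- The modular function `Δ` of `G`, with the normalization
`Δ(g) ∫ f(t g) dt = ∫ f(t) dt` for the left Haar integral. -/
noncomputable def modularFn : G →* ℝ where
  toFun g := (Measure.modularCharacter g : ℝ)⁻¹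
  map_one' := by simp
  map_mul' g h := by simp [mul_comm]

theorem modularFn_pos (g : G) : 0 < modularFn g :=
  inv_pos.2 (NNReal.coe_pos.2 (Measure.modularCharacterFun_pos g))

variable [MeasurableSpace G] [BorelSpace G]

theorem modularFn_mul_integral (μ : Measure G) [μ.IsHaarMeasure] (h : G) {f : G → ℝ}
    (hf : Continuous f) (hf' : HasCompactSupport f) :
    modularFn h * ∫ g, f (g * h) ∂μ = ∫ g, f g ∂μ := by
  have h1 : ∫ g, f (g * h) ∂μ = ∫ g, f g ∂(μ.map (· * h)) := by
    rw [integral_map (measurable_mul_const h).aemeasurable hf.aestronglyMeasurable]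
  rw [h1, Measure.integral_isMulLeftInvariant_eq_smul_of_hasCompactSupport _ μ hf hf',
    ← Measure.modularCharacterFun_eq_haarScalarFactor, integral_smul_nnreal_measure,
    NNReal.smul_def, smul_eq_mul, ← mul_assoc]
  have : (Measure.modularCharacterFun h : ℝ) ≠ 0 :=
    (NNReal.coe_pos.2 (Measure.modularCharacterFun_pos h)).ne'
  change (Measure.modularCharacterFun h : ℝ)⁻¹ * _ * _ = _
  rw [inv_mul_cancel₀ this, one_mul]

namespace TwistedCc

variable {μ : Measure G} {E : Twist G}

/-- The operator `ξ ↦ √Δ(q y) ξ(· y)` on `C_c(E, ι)`. -/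
noncomputable def translate (y : E.carrier) : TwistedCc μ E →ₗ[ℂ] TwistedCc μ E where
  toFun ξ := ⟨fun x => (√(modularFn (E.q y)) : ℂ) * ξ (x * y), by
    have := E.isTwist.isTopologicalGroup
    refine ⟨continuous_const.mul (ξ.continuous_coe.comp (continuous_mul_const y)), ?_, ?_⟩
    · exact (ξ.hasCompactSupport_coe.comp_homeomorph (Homeomorph.mulRight y)).mul_left
    · intro x z
      have : x * E.ι z * y = x * y * E.ι z := by
        rw [mul_assoc, mul_assoc, Subgroup.mem_center_iff.1 (E.isTwist.central z) y]
      change (√(modularFn (E.q y)) : ℂ) * ξ (x * E.ι z * y) =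
        z * ((√(modularFn (E.q y)) : ℂ) * ξ (x * y))
      rw [this, apply_mul_ι, mul_left_comm]⟩
  map_add' ξ η := Subtype.ext <| funext fun x => mul_add _ _ _
  map_smul' c ξ := Subtype.ext <| funext fun x => mul_left_comm _ _ _

theorem translate_apply (y : E.carrier) (ξ : TwistedCc μ E) (x : E.carrier) :
    translate y ξ x = (√(modularFn (E.q y)) : ℂ) * ξ (x * y) := rfl

theorem translate_one (ξ : TwistedCc μ E) : translate 1 ξ = ξ :=
  Subtype.ext <| funext fun x => by
    simp [translate_apply]

theorem translate_mul (y y' : E.carrier) (ξ : TwistedCc μ E) :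
    translate (y * y') ξ = translate y (translate y' ξ) :=
  Subtype.ext <| funext fun x => by
    simp only [translate_apply, map_mul, mul_assoc, Real.sqrt_mul (modularFn_pos _).le,
      Complex.ofReal_mul]

theorem translate_ι (z : Circle) (ξ : TwistedCc μ E) : translate (E.ι z) ξ = (z : ℂ) • ξ :=
  Subtype.ext <| funext fun x => by
    change translate (E.ι z) ξ x = z * ξ x
    have : E.q (E.ι z) = 1 := by
      rw [← MonoidHom.mem_ker, E.isTwist.ker_q]; exact ⟨z, rfl⟩
    simp [translate_apply, this, apply_mul_ι]

theorem norm_translate [μ.IsHaarMeasure] (y : E.carrier) (ξ : TwistedCc μ E) :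
    ‖translate y ξ‖ = ‖ξ‖ := by
  have key : ‖translate y ξ‖ ^ 2 = ‖ξ‖ ^ 2 := by
    set F : G → ℝ := fun g => (pairing ξ ξ g).re with hF
    have hFq : ∀ x, F (E.q x) = ‖ξ x‖ ^ 2 := fun x => by
      rw [hF]
      simp only [pairing_q]
      rw [mul_comm, Complex.mul_conj, Complex.ofReal_re, Complex.normSq_eq_norm_sq]
    have hc : Continuous F := Complex.continuous_re.comp (continuous_pairing ξ ξ)
    have hs : HasCompactSupport F :=
      (hasCompactSupport_pairing ξ ξ).comp_left (g := Complex.re) rfl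
    have h1 : ∀ g, ‖translate y ξ (sec E g)‖ ^ 2 = modularFn (E.q y) * F (g * E.q y) := by
      intro g
      have : g * E.q y = E.q (sec E g * y) := by rw [map_mul, q_sec]
      rw [this, hFq, translate_apply, norm_mul, mul_pow, Complex.norm_real, Real.norm_eq_abs,
        sq_abs, Real.sq_sqrt (modularFn_pos _).le]
    have h2 : ∀ g, ‖ξ (sec E g)‖ ^ 2 = F g := fun g => by rw [← hFq, q_sec]
    rw [norm_sq, norm_sq]
    simp only [h1, h2]
    rw [integral_const_mul, modularFn_mul_integral μ _ hc hs]
  exact (pow_left_inj₀ (norm_nonneg _) (norm_nonneg _) two_ne_zero).1 key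

/-- `translate y` as a linear equivalence. -/
noncomputable def translateEquiv (y : E.carrier) : TwistedCc μ E ≃ₗ[ℂ] TwistedCc μ E :=
  LinearEquiv.ofLinearMap (translate y) (translate y⁻¹)
    (by ext1 ξ; simp [← translate_mul, translate_one])
    (by ext1 ξ; simp [← translate_mul, translate_one])

end TwistedCc

variable (μ : Measure G) [μ.IsHaarMeasure] (E : Twist G)

/-- The Hilbert space `L²(E, ι)`, the completion of `C_c(E, ι)`. -/
abbrev TwistedL2 : Type u := UniformSpace.Completion (TwistedCc μ E)

variable {E} in
/-- The inclusion of `C_c(E, ι)` in `L²(E, ι)`. -/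
noncomputable def TwistedL2.incl : TwistedCc μ E →ₗ[ℂ] TwistedL2 μ E :=
  (UniformSpace.Completion.toComplₗᵢ (𝕜 := ℂ)).toLinearMap

variable {μ E} in
theorem TwistedL2.denseRange_incl : DenseRange (TwistedL2.incl μ (E := E)) :=
  UniformSpace.Completion.denseRange_coe

variable {E} in
/-- The unitary `ρ(y)` on `L²(E, ι)`, given by `(ρ(y) ξ)(x) = √Δ(q y) ξ(x y)`
for `ξ ∈ C_c(E, ι)`. -/
noncomputable def regularUnitary (y : E.carrier) : TwistedL2 μ E ≃ₗᵢ[ℂ] TwistedL2 μ E :=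
  (TwistedCc.translateEquiv y).extendOfIsometry (TwistedL2.incl μ) (TwistedL2.incl μ)
    TwistedL2.denseRange_incl TwistedL2.denseRange_incl
    fun ξ => by
      change ‖((TwistedCc.translate y ξ : TwistedCc μ E) : TwistedL2 μ E)‖ = ‖(ξ : TwistedL2 μ E)‖
      rw [UniformSpace.Completion.norm_coe, UniformSpace.Completion.norm_coe,
        TwistedCc.norm_translate]

variable {E} in
theorem regularUnitary_incl (y : E.carrier) (ξ : TwistedCc μ E) :
    regularUnitary μ y (TwistedL2.incl μ ξ) = TwistedL2.incl μ (TwistedCc.translate y ξ) :=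
  LinearEquiv.extendOfIsometry_eq _ _ _ _ _ _ _

variable {μ E} in
theorem linearIsometryEquiv_ext {v w : TwistedL2 μ E ≃ₗᵢ[ℂ] TwistedL2 μ E}
    (h : ∀ ξ : TwistedCc μ E, v (TwistedL2.incl μ ξ) = w (TwistedL2.incl μ ξ)) : v = w := by
  ext x
  exact congrFun (TwistedL2.denseRange_incl.equalizer v.continuous w.continuous (funext h)) x

/-- The right regular representation `ρ : E → 𝒰(L²(E, ι))`. -/
noncomputable def regularRep : E.carrier →* (TwistedL2 μ E ≃ₗᵢ[ℂ] TwistedL2 μ E) where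
  toFun := regularUnitary μ
  map_one' := linearIsometryEquiv_ext fun ξ => by
    rw [regularUnitary_incl, TwistedCc.translate_one]; rfl
  map_mul' y y' := linearIsometryEquiv_ext fun ξ => by
    rw [regularUnitary_incl, TwistedCc.translate_mul]
    change _ = regularUnitary μ y (regularUnitary μ y' (TwistedL2.incl μ ξ))
    rw [regularUnitary_incl, regularUnitary_incl]

theorem regularRep_ι (z : Circle) :
    regularRep μ E (E.ι z) = scalarUnitary (TwistedL2 μ E) z :=
  linearIsometryEquiv_ext fun ξ => by
    change regularUnitary μ (E.ι z) _ = _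
    rw [regularUnitary_incl, TwistedCc.translate_ι, scalarUnitary_apply, map_smul]

/-- The homomorphism `G → Aut 𝒦(L²(E, ι))` through which `Ad ρ : E → Aut 𝒦(L²(E, ι))` factors:
it maps `q y` to `Ad ρ(y)`. -/
noncomputable def regularHom : CompactHom G where
  H := TwistedL2 μ E
  α := E.descendAd (regularRep μ E) (regularRep_ι μ E)

theorem regularHom_q (y : E.carrier) :
    (regularHom μ E).α (E.q y) = Ad (TwistedL2 μ E) (regularRep μ E y) :=
  E.descendAd_q (regularRep μ E) (regularRep_ι μ E) y

end RegularAction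

end GroupTwist

/-! The class of $G_\alpha$ is a complete Morita invariant of $\alpha$, and every twist arises as
some $G_\alpha$.

$G_\alpha$ is a twist because every automorphism of $\mathcal K(\mathcal H)$ is $\mathrm{Ad}\,v$ for
a unitary $v$ unique up to a scalar. If $\xi$ is a unit vector and $p=|\xi\rangle\langle\xi|$, then
near $e$ one may take $v_g x=\alpha_g(|x\rangle\langle\xi|)\eta_g$ with
$\eta_g=\alpha_g(p)\xi/\|\alpha_g(p)\xi\|$. This is strongly continuous at $e$, so $q_\alpha$ is
open (`CompactHom.isOpenQuotientMap_extension_q`); local compactness passes up because the kernel is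
compact.

Every unitary representation of a twist $\tilde G$ that implements $\alpha$ and is scalar on
$\mathbb T$ gives a morphism $\tilde G\to G_\alpha$. Continuous morphisms of twists over the
identities of $G$ and $\mathbb T$ are isomorphisms (`Twist.equivalent_of_continuous`), so $\tilde
G\cong G_{\tilde\alpha}$ by way of $\tilde\rho$. Here $\tilde\rho$ must be shown strongly continuous
and $L^2(\tilde G,\iota)$ nonzero.

If $G_\alpha\cong G_\beta$, then one twist implements both actions, by representations $u$ and $v$.
The maps $T\mapsto uTv^*$ on $\mathcal K(\mathcal H_\beta,\mathcal H_\alpha)$ are insensitive to the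
phases and descend to $G$, which gives a Morita equivalence (`moritaEquivalent_of_rep`). Conversely,
let $(\mathcal X,\gamma)$ be a Morita equivalence. For rank one projections $p$, $q$ with $p\mathcal
Xq\ne0$ this corner is a line; let $x_0$ be a unit vector in it. For $(g,u)\in G_\alpha$ there is a
unique $(g,v)\in G_\beta$ with $\gamma_g(x_0)=u x_0 v^*$, and $(g,u)\mapsto(g,v)$ is the isomorphism
(`twist_equivalent_of_moritaEquivalent`).

Thus Morita equivalence is equality of the classes $[G_\alpha]$. That it is an equivalence relation,
and the bijection, follow. -/

namespace GroupTwist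

open Filter Topology InnerProductSpace

/-! ### Rank one operators and automorphisms of the compact operators -/

section CompactOperators

theorem isCompactOperator_rankOne {H K : Type*} [NormedAddCommGroup H] [InnerProductSpace ℂ H]
    [NormedAddCommGroup K] [InnerProductSpace ℂ K] (x : K) (y : H) :
    IsCompactOperator (rankOne ℂ x y) := by
  have h : IsCompactOperator (innerSL ℂ y : H →L[ℂ] ℂ) :=
    isCompactOperator_of_locallyCompactSpace_dom (T := (innerSL ℂ y : H →L[ℂ] ℂ))
  rw [rankOne_def']
  exact h.clm_comp (ContinuousLinearMap.toSpanSingleton ℂ x)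

variable {H : Type u} [NormedAddCommGroup H] [InnerProductSpace ℂ H] [CompleteSpace H]

/-- The rank one operator `z ↦ ⟨y, z⟩ x` as an element of `𝒦(H)`. -/
noncomputable def rankOneOp (x y : H) : compactOps H :=
  ⟨rankOne ℂ x y, isCompactOperator_rankOne x y⟩

theorem compactOps_ext {S T : compactOps H} (h : ∀ x, (S : H →L[ℂ] H) x = (T : H →L[ℂ] H) x) :
    S = T :=
  Subtype.ext (ContinuousLinearMap.ext h)

theorem rankOneOp_apply (x y z : H) : (rankOneOp x y : H →L[ℂ] H) z = inner ℂ y z • x := rfl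

theorem coe_mul_apply (S T : compactOps H) (z : H) :
    ((S * T : compactOps H) : H →L[ℂ] H) z = (S : H →L[ℂ] H) ((T : H →L[ℂ] H) z) := rfl

theorem aut_star (α : compactOps H ≃⋆ₐ[ℂ] compactOps H) (T : compactOps H) :
    α (star T) = star (α T) := α.map_star' T

theorem inner_star_apply (T : compactOps H) (x y : H) :
    inner ℂ (((star T : compactOps H) : H →L[ℂ] H) x) y = inner ℂ x ((T : H →L[ℂ] H) y) :=
  ContinuousLinearMap.adjoint_inner_left _ _ _

theorem norm_rankOneOp (x y : H) : ‖rankOneOp x y‖ = ‖x‖ * ‖y‖ := norm_rankOne x y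

theorem star_rankOneOp (x y : H) : star (rankOneOp x y) = rankOneOp y x :=
  Subtype.ext (adjoint_rankOne x y)

theorem mul_rankOneOp (T : compactOps H) (x y : H) :
    T * rankOneOp x y = rankOneOp ((T : H →L[ℂ] H) x) y :=
  Subtype.ext (comp_rankOne x y (T : H →L[ℂ] H))

theorem rankOneOp_add_left (x x' y : H) :
    rankOneOp (x + x') y = rankOneOp x y + rankOneOp x' y :=
  Subtype.ext (by simp [rankOneOp])

theorem rankOneOp_smul_left (c : ℂ) (x y : H) : rankOneOp (c • x) y = c • rankOneOp x y :=
  Subtype.ext (by simp [rankOneOp])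

theorem rankOneOp_smul_right (c : ℂ) (x y : H) :
    rankOneOp x (c • y) = conj c • rankOneOp x y :=
  Subtype.ext (by simp [rankOneOp])

theorem rankOneOp_mul_rankOneOp (x y z w : H) :
    rankOneOp x y * rankOneOp z w = inner ℂ y z • rankOneOp x w := by
  rw [mul_rankOneOp, rankOneOp_apply, rankOneOp_smul_left]

theorem rankOneOp_mul_rankOneOp_of_norm_one {y : H} (hy : ‖y‖ = 1) (x w : H) :
    rankOneOp x y * rankOneOp y w = rankOneOp x w := by
  simp [rankOneOp_mul_rankOneOp, hy]

theorem continuous_compactOps_iff {Y : Type*} [TopologicalSpace Y] {f : Y → compactOps H} :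
    Continuous f ↔ Continuous fun y => (f y : H →L[ℂ] H) :=
  Topology.IsInducing.subtypeVal.continuous_iff

theorem continuous_rankOneOp : Continuous fun p : H × H => rankOneOp p.1 p.2 := by
  have h : Continuous fun p : H × H => rankOne ℂ p.1 p.2 :=
    (ContinuousLinearMap.smulRightL ℂ H H).continuous₂.comp
      (((innerSL ℂ (E := H)).continuous.comp continuous_snd).prodMk continuous_fst)
  exact continuous_compactOps_iff.2 h

theorem Ad_rankOneOp (v : H ≃ₗᵢ[ℂ] H) (x y : H) :
    Ad H v (rankOneOp x y) = rankOneOp (v x) (v y) := by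
  refine compactOps_ext fun z => ?_
  rw [coe_Ad_apply, rankOneOp_apply, rankOneOp_apply, map_smul]
  congr 1
  rw [← v.inner_map_map, v.apply_symm_apply]

/-- Compact operators between Hilbert spaces are limits of finite rank operators. -/
theorem mem_closure_span_rankOne {H K : Type*} [NormedAddCommGroup H] [InnerProductSpace ℂ H]
    [CompleteSpace H] [NormedAddCommGroup K] [InnerProductSpace ℂ K] [CompleteSpace K]
    {T : H →L[ℂ] K} (hT : IsCompactOperator T) :
    T ∈ closure (Submodule.span ℂ (Set.range fun p : K × H => rankOne ℂ p.1 p.2) :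
      Set (H →L[ℂ] K)) := by
  have hTB : TotallyBounded ((T : H → K) '' Metric.closedBall 0 1) :=
    (IsCompactOperator.isCompact_closure_image_closedBall
      (f := (T : H →ₗ[ℂ] K)) hT 1).totallyBounded.subset subset_closure
  refine Metric.mem_closure_iff.2 fun ε hε => ?_
  obtain ⟨t, ht, hcov⟩ := Metric.totallyBounded_iff.1 hTB (ε / 2) (by positivity)
  -- `t` is a finite `ε / 2`-net of the image of the unit ball. The projection onto its span moves a
  -- point of that image no farther than the distance to the nearest net point.
  let V : Submodule ℂ K := Submodule.span ℂ t
  have : FiniteDimensional ℂ V := FiniteDimensional.span_of_finite ℂ ht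
  refine ⟨V.starProjection ∘L T, ?_, ?_⟩
  · rw [OrthonormalBasis.starProjection_eq_sum_rankOne (stdOrthonormalBasis ℂ V)]
    have : (∑ i, rankOne ℂ ((stdOrthonormalBasis ℂ V i : V) : K)
        ((stdOrthonormalBasis ℂ V i : V) : K)) ∘L T =
        ∑ i, rankOne ℂ ((stdOrthonormalBasis ℂ V i : V) : K)
          (ContinuousLinearMap.adjoint T ((stdOrthonormalBasis ℂ V i : V) : K)) := by
      ext x
      simp [ContinuousLinearMap.adjoint_inner_left]
    rw [this]
    exact Submodule.sum_mem _ fun i _ => Submodule.subset_span ⟨(_, _), rfl⟩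
  · rw [dist_eq_norm]
    refine lt_of_le_of_lt (ContinuousLinearMap.opNorm_le_of_unit_norm (C := ε / 2) (by positivity)
      fun x hx => ?_) (by linarith)
    have hm := hcov (Set.mem_image_of_mem T (by simp [hx] : x ∈ Metric.closedBall (0 : H) 1))
    simp only [Set.mem_iUnion] at hm
    obtain ⟨c, hc, hxc⟩ := hm
    rw [Metric.mem_ball, dist_eq_norm] at hxc
    have hcV : c ∈ V := Submodule.subset_span hc
    change ‖T x - V.starProjection (T x)‖ ≤ _
    rw [Submodule.starProjection_minimal]
    exact (ciInf_le ⟨0, by rintro _ ⟨y, rfl⟩; exact norm_nonneg _⟩ (⟨c, hcV⟩ : V)).trans hxc.le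

theorem dense_span_rankOneOp :
    Dense (Submodule.span ℂ (Set.range fun p : H × H => rankOneOp p.1 p.2) :
      Set (compactOps H)) := by
  intro T
  rw [Topology.IsEmbedding.subtypeVal.closure_eq_preimage_closure_image, Set.mem_preimage]
  have h := mem_closure_span_rankOne T.2
  convert h using 2
  have := Submodule.map_span (compactOps H).toSubmodule.subtype
    (Set.range fun p : H × H => rankOneOp p.1 p.2)
  rw [← Set.range_comp] at this
  exact congrArg SetLike.coe this

/-- A unitary `v` is determined by `Ad v` up to a scalar. -/
theorem exists_scalar_of_Ad_eq [Nontrivial H] {v w : H ≃ₗᵢ[ℂ] H} (h : Ad H v = Ad H w) :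
    ∃ z : Circle, w = v * scalarUnitary H z := by
  obtain ⟨ξ, hξ⟩ := exists_norm_eq H (zero_le_one (α := ℝ))
  -- Both unitaries carry $|x\rangle\langle\xi|$ to the same operator, $|vx\rangle\langle
  -- v\xi|=|wx\rangle\langle w\xi|$. Evaluation at $w\xi$ gives the formula, with a scalar that does
  -- not depend on $x$.
  have key : ∀ x, w x = inner ℂ (v ξ) (w ξ) • v x := fun x => by
    have h1 : Ad H v (rankOneOp x ξ) = Ad H w (rankOneOp x ξ) := by rw [h]
    rw [Ad_rankOneOp, Ad_rankOneOp] at h1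
    have h2 := congrArg (fun T : compactOps H => (T : H →L[ℂ] H) (w ξ)) h1
    simp only [rankOneOp_apply] at h2
    rw [h2, inner_self_eq_norm_sq_to_K, w.norm_map, hξ]
    simp
  have hc : ‖inner ℂ (v ξ) (w ξ)‖ = 1 := by
    have := congrArg norm (key ξ)
    rw [norm_smul, w.norm_map, v.norm_map, hξ, mul_one] at this
    exact this.symm
  refine ⟨⟨inner ℂ (v ξ) (w ξ), by simpa [Submonoid.unitSphere] using hc⟩, ?_⟩
  ext x
  rw [key x, ← map_smul]
  rfl

/-- If `η` is a unit vector in the range of `α(|ξ⟩⟨ξ|)`, then `x ↦ α(|x⟩⟨ξ|) η` is a unitary that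
implements the automorphism `α` of `𝒦(H)`. -/
theorem exists_unitary_of_unit_vector {ξ η : H} (hη : ‖η‖ = 1)
    (α : compactOps H ≃⋆ₐ[ℂ] compactOps H)
    (hα : (α (rankOneOp ξ ξ) : H →L[ℂ] H) η = η) :
    ∃ v : H ≃ₗᵢ[ℂ] H, (∀ x, v x = (α (rankOneOp x ξ) : H →L[ℂ] H) η) ∧ α = Ad H v := by
  -- The formula is forced: $\mathrm{Ad}\,v$ sends $|x\rangle\langle\xi|$ to $|vx\rangle\langle
  -- v\xi|$, which maps $\eta=v\xi$ to $vx$.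
  let V : H →ₗ[ℂ] H :=
    { toFun := fun x => (α (rankOneOp x ξ) : H →L[ℂ] H) η
      map_add' := fun x y => by rw [rankOneOp_add_left, map_add]; rfl
      map_smul' := fun c x => by rw [rankOneOp_smul_left, map_smul]; rfl }
  have hV : ∀ x, V x = (α (rankOneOp x ξ) : H →L[ℂ] H) η := fun _ => rfl
  have hinner : ∀ x y, inner ℂ (V x) (V y) = inner ℂ x y := fun x y => by
    rw [hV, hV, ← star_star (α (rankOneOp x ξ)), inner_star_apply, ← coe_mul_apply, ← aut_star,
      ← map_mul, star_rankOneOp, rankOneOp_mul_rankOneOp, map_smul]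
    change inner ℂ η (inner ℂ x y • (α (rankOneOp ξ ξ) : H →L[ℂ] H) η) = _
    rw [hα, inner_smul_right, inner_self_eq_norm_sq_to_K, hη]
    simp
  have hcomm : ∀ (T : compactOps H) x, V ((T : H →L[ℂ] H) x) = (α T : H →L[ℂ] H) (V x) :=
    fun T x => by rw [hV, hV, ← mul_rankOneOp, map_mul, coe_mul_apply]
  -- By `hcomm`, and since $V\xi=\eta$, the vector $y=|y\rangle\langle\eta|\,\eta$ is the image of
  -- $\alpha^{-1}(|y\rangle\langle\eta|)\,\xi$.
  have hsurj : Function.Surjective V := fun y => by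
    refine ⟨(α.symm (rankOneOp y η) : H →L[ℂ] H) ξ, ?_⟩
    rw [hcomm, α.apply_symm_apply, hV, hα, rankOneOp_apply, inner_self_eq_norm_sq_to_K, hη]
    simp
  let v : H ≃ₗᵢ[ℂ] H := LinearIsometryEquiv.ofSurjective (V.isometryOfInner hinner) hsurj
  have hv : ∀ x, v x = V x := fun _ => rfl
  refine ⟨v, fun x => rfl, ?_⟩
  ext T y
  rw [coe_Ad_apply, hv, hcomm, ← hv, v.apply_symm_apply]

end CompactOperators

/-! ### The strong operator topology on the unitary group -/

section StrongTopology

variable {H : Type*} [NormedAddCommGroup H] [InnerProductSpace ℂ H]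

/-- Isometries are uniformly equicontinuous, so pointwise convergence tolerates a moving argument.
This makes multiplication in $G_\alpha$ jointly continuous. -/
theorem tendsto_unitary_apply {Y : Type*} {l : Filter Y} {v : Y → H ≃ₗᵢ[ℂ] H} {w : H ≃ₗᵢ[ℂ] H}
    (hv : ∀ x, Tendsto (fun y => v y x) l (𝓝 (w x))) {f : Y → H} {x : H}
    (hf : Tendsto f l (𝓝 x)) : Tendsto (fun y => v y (f y)) l (𝓝 (w x)) := by
  have h1 : Tendsto (fun y => v y (f y) - v y x) l (𝓝 0) := by
    rw [tendsto_zero_iff_norm_tendsto_zero]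
    have : ∀ y, ‖v y (f y) - v y x‖ = ‖f y - x‖ := fun y => by
      rw [← map_sub, LinearIsometryEquiv.norm_map]
    simp only [this]
    exact tendsto_iff_norm_sub_tendsto_zero.1 hf
  simpa using h1.add (hv x)

theorem continuous_unitary_apply {Y : Type*} [TopologicalSpace Y] {v : Y → H ≃ₗᵢ[ℂ] H}
    (hv : ∀ x, Continuous fun y => v y x) {f : Y → H} (hf : Continuous f) :
    Continuous fun y => v y (f y) :=
  continuous_iff_continuousAt.2 fun _ =>
    tendsto_unitary_apply (fun x => (hv x).continuousAt) hf.continuousAt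

/-- Inversion is strongly continuous because $\|v_t^{-1}x-v_y^{-1}x\|=\|v_tv_y^{-1}x-x\|$. -/
theorem continuous_unitary_symm_apply {Y : Type*} [TopologicalSpace Y] {v : Y → H ≃ₗᵢ[ℂ] H}
    (hv : ∀ x, Continuous fun y => v y x) (x : H) : Continuous fun y => (v y).symm x := by
  refine continuous_iff_continuousAt.2 fun y => ?_
  rw [ContinuousAt, tendsto_iff_norm_sub_tendsto_zero]
  have : ∀ t, ‖(v t).symm x - (v y).symm x‖ = ‖v t ((v y).symm x) - x‖ := fun t => by
    rw [← (v t).norm_map, map_sub, (v t).apply_symm_apply, norm_sub_rev]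
  simp only [this]
  rw [← tendsto_iff_norm_sub_tendsto_zero]
  simpa using (hv ((v y).symm x)).tendsto y

end StrongTopology

/-! ### Automorphisms of the compact operators are inner -/

section Implementation

variable {H : Type u} [NormedAddCommGroup H] [InnerProductSpace ℂ H] [CompleteSpace H]

theorem norm_inv_norm_smul {x : H} (hx : x ≠ 0) : ‖((‖x‖⁻¹ : ℝ) : ℂ) • x‖ = 1 := by
  rw [norm_smul, Complex.norm_real, norm_inv, norm_norm, inv_mul_cancel₀ (norm_ne_zero_iff.2 hx)]

/-- Every automorphism `α` of `𝒦(H)` is inner, and there is an implementing unitary that depends on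
`α` by an explicit formula as long as `α` is close to the identity. -/
theorem exists_unitary_implementing {ξ : H} (hξ : ‖ξ‖ = 1)
    (α : compactOps H ≃⋆ₐ[ℂ] compactOps H) :
    ∃ v : H ≃ₗᵢ[ℂ] H, α = Ad H v ∧ ((α (rankOneOp ξ ξ) : H →L[ℂ] H) ξ ≠ 0 →
      ∀ x, v x = (α (rankOneOp x ξ) : H →L[ℂ] H)
        (((‖(α (rankOneOp ξ ξ) : H →L[ℂ] H) ξ‖⁻¹ : ℝ) : ℂ) •
          (α (rankOneOp ξ ξ) : H →L[ℂ] H) ξ)) := by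
  have key : ∀ ζ, (α (rankOneOp ξ ξ) : H →L[ℂ] H) ζ ≠ 0 →
      ∃ v : H ≃ₗᵢ[ℂ] H, (∀ x, v x = (α (rankOneOp x ξ) : H →L[ℂ] H)
        (((‖(α (rankOneOp ξ ξ) : H →L[ℂ] H) ζ‖⁻¹ : ℝ) : ℂ) •
          (α (rankOneOp ξ ξ) : H →L[ℂ] H) ζ)) ∧ α = Ad H v := fun ζ hζ => by
    refine exists_unitary_of_unit_vector (norm_inv_norm_smul hζ) α ?_
    rw [map_smul, ← coe_mul_apply, ← map_mul, rankOneOp_mul_rankOneOp_of_norm_one hξ]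
  -- If $\alpha(p)$ kills $\xi$, any vector not killed by $\alpha(p)$ replaces it; the explicit
  -- formula is claimed only in the other case.
  by_cases h : (α (rankOneOp ξ ξ) : H →L[ℂ] H) ξ = 0
  · have h0 : α (rankOneOp ξ ξ) ≠ 0 := fun h0 => by
      have h1 : rankOneOp ξ ξ = 0 := α.injective (h0.trans (map_zero α).symm)
      have h2 := norm_rankOneOp ξ ξ
      rw [h1, hξ, norm_zero] at h2
      norm_num at h2
    obtain ⟨ζ, hζ⟩ : ∃ ζ, (α (rankOneOp ξ ξ) : H →L[ℂ] H) ζ ≠ 0 := by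
      by_contra! hc
      exact h0 (compactOps_ext hc)
    obtain ⟨v, -, hv⟩ := key ζ hζ
    exact ⟨v, hv, fun h' => absurd h h'⟩
  · obtain ⟨v, hv, hv'⟩ := key ξ h
    exact ⟨v, hv', fun _ => hv⟩

end Implementation

/-! ### The extension $G_\alpha$ -/

section Extension

variable {G : Type u} [Group G] [TopologicalSpace G]

theorem CompactHom.isInducing_extension (a : CompactHom G) :
    IsInducing (fun p : a.extension.carrier =>
      ((p.1.1, (p.1.2 : a.H → a.H)) : G × (a.H → a.H))) := ⟨rfl⟩

theorem CompactHom.continuous_extension_iff (a : CompactHom G) {Y : Type*} [TopologicalSpace Y]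
    {f : Y → a.extension.carrier} :
    Continuous f ↔ Continuous (fun y => (f y).1.1) ∧ ∀ x, Continuous fun y => (f y).1.2 x := by
  rw [a.isInducing_extension.continuous_iff]
  exact continuous_prodMk.trans (and_congr Iff.rfl continuous_pi_iff)

theorem CompactHom.tendsto_extension_iff (a : CompactHom G) {Y : Type*} {l : Filter Y}
    {f : Y → a.extension.carrier} {p : a.extension.carrier} :
    Tendsto f l (𝓝 p) ↔ Tendsto (fun y => (f y).1.1) l (𝓝 p.1.1) ∧
      ∀ x, Tendsto (fun y => (f y).1.2 x) l (𝓝 (p.1.2 x)) := by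
  rw [a.isInducing_extension.tendsto_nhds_iff, nhds_prod_eq, tendsto_prod_iff']
  exact and_congr Iff.rfl tendsto_pi_nhds

theorem CompactHom.continuous_extension_fst (a : CompactHom G) :
    Continuous fun p : a.extension.carrier => p.1.1 :=
  (a.continuous_extension_iff.1 continuous_id).1

theorem CompactHom.continuous_extension_snd (a : CompactHom G) (x : a.H) :
    Continuous fun p : a.extension.carrier => p.1.2 x :=
  (a.continuous_extension_iff.1 continuous_id).2 x

variable [IsTopologicalGroup G]

theorem CompactHom.isTopologicalGroup_extension (a : CompactHom G) :
    IsTopologicalGroup a.extension.carrier where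
  continuous_mul := by
    refine a.continuous_extension_iff.2 ⟨?_, fun x => ?_⟩
    · exact (a.continuous_extension_fst.comp continuous_fst).mul
        (a.continuous_extension_fst.comp continuous_snd)
    · exact continuous_unitary_apply
        (v := fun p : a.extension.carrier × a.extension.carrier => p.1.1.2)
        (fun x => (a.continuous_extension_snd x).comp continuous_fst)
        ((a.continuous_extension_snd x).comp continuous_snd)
  continuous_inv := by
    refine a.continuous_extension_iff.2 ⟨a.continuous_extension_fst.inv, fun x => ?_⟩
    exact continuous_unitary_symm_apply a.continuous_extension_snd x

theorem CompactHom.t2Space_extension [T2Space G] (a : CompactHom G) :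
    T2Space a.extension.carrier := by
  refine T2Space.of_injective_continuous (fun p q h => ?_) a.isInducing_extension.continuous
  have h1 := congrArg Prod.fst h
  have h2 := congrArg Prod.snd h
  exact Subtype.ext (Prod.ext h1 (DFunLike.coe_injective h2))

theorem CompactHom.isEmbedding_extension_ι [T2Space G] (a : CompactHom G) [Nontrivial a.H] :
    IsEmbedding a.extension.ι := by
  obtain ⟨ξ, hξ⟩ := exists_norm_eq a.H (zero_le_one (α := ℝ))
  have := a.t2Space_extension
  refine (Continuous.isClosedEmbedding ?_ fun z w h => ?_).isEmbedding
  · refine a.continuous_extension_iff.2 ⟨continuous_const, fun x => ?_⟩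
    change Continuous fun z : Circle => (z : ℂ) • x
    fun_prop
  · have h1 : (z : ℂ) • ξ = (w : ℂ) • ξ :=
      congrArg (fun p : a.extension.carrier => p.1.2 ξ) h
    have hξ0 : ξ ≠ 0 := by rintro rfl; simp at hξ
    exact Circle.ext (smul_left_injective ℂ hξ0 h1)

/-- A unitary implementing the identity automorphism is a scalar. -/
theorem CompactHom.ker_extension_q (a : CompactHom G) [Nontrivial a.H] :
    a.extension.q.ker = a.extension.ι.range := by
  ext p
  rw [MonoidHom.mem_ker]
  constructor
  · intro (hp : p.1.1 = 1)
    have h : a.α p.1.1 = Ad a.H p.1.2 := p.2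
    rw [hp, map_one, ← map_one (Ad a.H)] at h
    obtain ⟨z, hz⟩ := exists_scalar_of_Ad_eq h
    exact ⟨z, Subtype.ext (Prod.ext hp.symm (by rw [hz, one_mul]; rfl))⟩
  · rintro ⟨z, rfl⟩
    rfl

theorem CompactHom.extension_central (a : CompactHom G) (z : Circle) :
    a.extension.ι z ∈ Subgroup.center a.extension.carrier := by
  refine Subgroup.mem_center_iff.2 fun p => Subtype.ext (Prod.ext ?_ ?_)
  · exact (mul_one p.1.1).trans (one_mul p.1.1).symm
  · ext x
    exact map_smul p.1.2 (z : ℂ) x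

/-- Surjectivity holds because automorphisms are inner. Openness follows from a section that is
continuous at $1$ and maps $1$ to $1$: its translates are sections continuous at one point, through
every point of $G_\alpha$. -/
theorem CompactHom.isOpenQuotientMap_extension_q {a : CompactHom G} (ha : a.IsAction) :
    IsOpenQuotientMap a.extension.q := by
  have := ha.nontrivial
  have := a.isTopologicalGroup_extension
  obtain ⟨ξ, hξ⟩ := exists_norm_eq a.H (zero_le_one (α := ℝ))
  let w : G → a.H := fun g => (a.α g (rankOneOp ξ ξ) : a.H →L[ℂ] a.H) ξ
  have hw : Continuous w :=
    (continuous_compactOps_iff.1 (ha.continuous (rankOneOp ξ ξ))).clm_apply continuous_const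
  have hw1 : w 1 = ξ := by
    change ((a.α 1 (rankOneOp ξ ξ) : compactOps a.H) : a.H →L[ℂ] a.H) ξ = ξ
    rw [map_one]
    change (rankOneOp ξ ξ : a.H →L[ℂ] a.H) ξ = ξ
    rw [rankOneOp_apply, inner_self_eq_norm_sq_to_K, hξ]
    simp
  choose v hv hv' using fun g => exists_unitary_implementing hξ (a.α g)
  let s : G → a.extension.carrier := fun g => ⟨(g, v g), hv g⟩
  -- Where `w g` is nonzero, `v g` is given by the explicit formula; as $w(1)=\xi$, this covers a
  -- neighbourhood of $1$ and gives $v_1=1$.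
  have hf : ∀ᶠ g in 𝓝 (1 : G), w g ≠ 0 := by
    refine hw.continuousAt.eventually_ne ?_
    rw [hw1]
    rintro rfl
    simp at hξ
  have hs1 : s 1 = 1 := by
    refine Subtype.ext (Prod.ext rfl (LinearIsometryEquiv.ext fun x => ?_))
    change v 1 x = x
    refine (hv' 1 hf.self_of_nhds x).trans ?_
    change (a.α 1 (rankOneOp x ξ) : a.H →L[ℂ] a.H) (((‖w 1‖⁻¹ : ℝ) : ℂ) • w 1) = x
    rw [hw1, map_one]
    change (rankOneOp x ξ : a.H →L[ℂ] a.H) _ = x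
    rw [hξ, rankOneOp_apply]
    simp [hξ]
  have hs : ContinuousAt s 1 := by
    refine a.tendsto_extension_iff.2 ⟨tendsto_id, fun x => ?_⟩
    have h1 : ContinuousAt (fun g => (a.α g (rankOneOp x ξ) : a.H →L[ℂ] a.H)
        (((‖w g‖⁻¹ : ℝ) : ℂ) • w g)) 1 := by
      refine (continuous_compactOps_iff.1 (ha.continuous (rankOneOp x ξ))).continuousAt.clm_apply
        (ContinuousAt.smul ?_ hw.continuousAt)
      exact Complex.continuous_ofReal.continuousAt.comp
        (hw.continuousAt.norm.inv₀ (norm_ne_zero_iff.2 hf.self_of_nhds))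
    refine Tendsto.congr' ?_ (h1.tendsto.trans_eq (congrArg 𝓝 (hv' 1 hf.self_of_nhds x).symm))
    filter_upwards [hf] with g hg
    exact (hv' g hg x).symm
  refine ⟨fun g => ⟨s g, rfl⟩, a.continuous_extension_fst, IsOpenMap.of_sections fun p =>
    ⟨fun g => p * s ((a.extension.q p)⁻¹ * g), ?_, ?_, fun g => ?_⟩⟩
  · have h2 : ContinuousAt (fun g => (a.extension.q p)⁻¹ * g) (a.extension.q p) :=
      (continuous_const_mul _).continuousAt
    refine continuousAt_const.mul (ContinuousAt.comp (g := s) ?_ h2)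
    rwa [inv_mul_cancel]
  · simp only [inv_mul_cancel, hs1, mul_one]
  · rw [map_mul]
    exact mul_inv_cancel_left (a.extension.q p) g

end Extension

/-! ### Local compactness of extensions and morphisms of twists -/

section Twists

variable {G : Type u} [Group G] [TopologicalSpace G]

/-- An extension of a locally compact group by a compact group is locally compact. -/
theorem locallyCompactSpace_of_isOpenQuotientMap {E : Type*} [Group E] [TopologicalSpace E]
    [IsTopologicalGroup E] [LocallyCompactSpace G] {q : E →* G} (hq : IsOpenQuotientMap q)
    (hker : IsCompact (q.ker : Set E)) : LocallyCompactSpace E := by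
  -- The saturation of a closed set $C$ is $C\cdot\ker q$, which is closed since $\ker q$ is
  -- compact, and the fibres are cosets of $\ker q$. The preimage of a compact neighbourhood of $1$
  -- is then one too.
  have hproper : IsProperMap q := by
    refine isProperMap_iff_isClosedMap_and_compact_fibers.2 ⟨hq.continuous, fun C hC => ?_,
      fun g => ?_⟩
    · rw [← hq.isQuotientMap.isClosed_preimage]
      convert hC.mul_right_of_isCompact hker
      ext x
      rw [Set.mem_preimage, Set.mem_mul]
      constructor
      · rintro ⟨c, hc, hcx⟩
        exact ⟨c, hc, c⁻¹ * x, by simp [MonoidHom.mem_ker, hcx], mul_inv_cancel_left c x⟩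
      · rintro ⟨c, hc, k, hk, rfl⟩
        exact ⟨c, hc, by rw [map_mul, MonoidHom.mem_ker.1 hk, mul_one]⟩
    · obtain ⟨y, rfl⟩ := hq.surjective g
      convert hker.image (continuous_const_mul y)
      ext x
      constructor
      · intro (hx : q x = q y)
        exact ⟨y⁻¹ * x, by simp [MonoidHom.mem_ker, hx], mul_inv_cancel_left y x⟩
      · rintro ⟨k, hk, rfl⟩
        change q (y * k) = q y
        rw [map_mul, MonoidHom.mem_ker.1 hk, mul_one]
  obtain ⟨K, hK, hK1⟩ := exists_compact_mem_nhds (1 : G)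
  refine (hproper.isCompact_preimage hK).locallyCompactSpace_of_mem_nhds_of_group (x := 1) ?_
  exact hq.continuous.continuousAt.preimage_mem_nhds (by rwa [map_one])

theorem CompactHom.IsAction.isTwist_extension [IsTopologicalGroup G] [LocallyCompactSpace G]
    [T2Space G] {a : CompactHom G} (ha : a.IsAction) : a.extension.IsTwist := by
  have := ha.nontrivial
  have := a.isTopologicalGroup_extension
  have hker : IsCompact (a.extension.q.ker : Set a.extension.carrier) := by
    rw [a.ker_extension_q, MonoidHom.coe_range]
    exact isCompact_range a.isEmbedding_extension_ι.continuous
  exact ⟨inferInstance,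
    locallyCompactSpace_of_isOpenQuotientMap (isOpenQuotientMap_extension_q ha) hker,
    a.t2Space_extension, a.isEmbedding_extension_ι, isOpenQuotientMap_extension_q ha,
    a.ker_extension_q, a.extension_central⟩

/-- The twist `G_α` associated with an action `α` on compact operators. -/
noncomputable def CompactAction.twist [IsTopologicalGroup G] [LocallyCompactSpace G]
    [T2Space G] (a : CompactAction G) : Twist G := ⟨a.extension, a.isAction.isTwist_extension⟩

/-- A continuous homomorphism between twists over the identity maps on `G` and `𝕋` is an
equivalence of twists. -/
theorem Twist.equivalent_of_continuous {E F : Twist G} (φ : E.carrier →* F.carrier)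
    (hφ : Continuous φ) (hι : ∀ z, φ (E.ι z) = F.ι z) (hq : ∀ x, F.q (φ x) = E.q x) :
    E.Equivalent F := by
  have := E.isTwist.isTopologicalGroup
  have := F.isTwist.isTopologicalGroup
  have hinj : Function.Injective φ := by
    refine (injective_iff_map_eq_one φ).2 fun x hx => ?_
    have : x ∈ E.q.ker := by rw [MonoidHom.mem_ker, ← hq, hx, map_one]
    rw [E.isTwist.ker_q] at this
    obtain ⟨z, rfl⟩ := this
    rw [hι, ← map_one F.ι] at hx
    rw [F.isTwist.isEmbedding_ι.injective hx, map_one]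
  have hdiv : ∀ x y, E.q x = F.q y → ∃ z, φ x * F.ι z = y := fun x y h => by
    have : (φ x)⁻¹ * y ∈ F.q.ker := by simp [MonoidHom.mem_ker, hq, h]
    rw [F.isTwist.ker_q] at this
    obtain ⟨z, hz⟩ := this
    exact ⟨z, by rw [hz, mul_inv_cancel_left]⟩
  have hsurj : Function.Surjective φ := fun y => by
    obtain ⟨x, hx⟩ := E.isTwist.isOpenQuotientMap_q.surjective (F.q y)
    obtain ⟨z, hz⟩ := hdiv x y hx
    exact ⟨x * E.ι z, by rw [map_mul, hι, hz]⟩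
  -- Openness at $1$. Take $W$ with $WW\subseteq\varphi^{-1}(V)$, then $N$ such that $\iota_F(z)\in
  -- N$ implies $\iota_E(z)\in W$, then $N_1^{-1}N_2\subseteq N$. For $y\in N_2$ near $1$, openness
  -- of $q_E$ gives $x\in W\cap\varphi^{-1}(N_1)$ over $q_F(y)$. So $y=\varphi(x)\iota_F(z)$ with
  -- $\iota_F(z)=\varphi(x)^{-1}y\in N$, and $y=\varphi(x\,\iota_E(z))\in V$.
  have hopen : 𝓝 1 ≤ map φ (𝓝 1) := fun V hV => by
    rw [mem_map] at hV
    obtain ⟨W, hW, hW1, hWV⟩ := exists_open_nhds_one_mul_subset hV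
    have h1 : E.ι ⁻¹' W ∈ 𝓝 (1 : Circle) :=
      E.isTwist.isEmbedding_ι.continuous.continuousAt.preimage_mem_nhds
        (by rw [map_one]; exact hW.mem_nhds hW1)
    rw [F.isTwist.isEmbedding_ι.isInducing.nhds_eq_comap, map_one, mem_comap] at h1
    obtain ⟨N, hN, hNW⟩ := h1
    have h2 : ∀ᶠ p : F.carrier × F.carrier in 𝓝 1 ×ˢ 𝓝 1, p.1⁻¹ * p.2 ∈ N := by
      rw [← nhds_prod_eq]
      refine ((continuous_fst.inv.mul continuous_snd).tendsto (1, 1)).eventually_mem ?_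
      simpa using hN
    obtain ⟨N₁, hN₁, N₂, hN₂, h3⟩ := eventually_prod_iff.1 h2
    have h4 : W ∩ φ ⁻¹' {y | N₁ y} ∈ 𝓝 (1 : E.carrier) :=
      inter_mem (hW.mem_nhds hW1) (hφ.continuousAt.preimage_mem_nhds (by rwa [map_one]))
    have h5 : E.q '' (W ∩ φ ⁻¹' {y | N₁ y}) ∈ 𝓝 (F.q 1) := by
      rw [map_one, ← map_one E.q]
      exact E.isTwist.isOpenQuotientMap_q.isOpenMap.image_mem_nhds h4
    filter_upwards [hN₂, F.isTwist.isOpenQuotientMap_q.continuous.continuousAt.preimage_mem_nhds h5]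
      with y hy ⟨x, ⟨hxW, hxN⟩, hxy⟩
    obtain ⟨z, rfl⟩ := hdiv x y hxy
    have h6 : z ∈ F.ι ⁻¹' N := by
      have := h3 hxN hy
      rwa [inv_mul_cancel_left] at this
    have := hWV (Set.mul_mem_mul hxW (hNW h6))
    rwa [Set.mem_preimage, map_mul, hι] at this
  have hopenMap : IsOpenMap φ := by
    refine IsOpenMap.of_nhds_le fun x => ?_
    rw [← map_mul_left_nhds_one (φ x), ← map_mul_left_nhds_one x, map_map,
      show φ ∘ (x * ·) = (φ x * ·) ∘ φ from funext fun y => map_mul φ x y, ← map_map]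
    exact map_mono hopen
  let e : E.carrier ≃* F.carrier := MulEquiv.ofBijective φ ⟨hinj, hsurj⟩
  have he : IsHomeomorph φ := ⟨hφ, hopenMap, hinj, hsurj⟩
  exact ⟨⟨e, hφ, (he.homeomorph φ).symm.continuous⟩, hι, hq⟩

end Twists

/-- Uniform limits of continuous functions are continuous. Hence continuity of the orbit maps of a
family of contractions need only be checked on a dense set. -/
theorem isClosed_setOf_continuous_apply {Y X Z : Type*} [TopologicalSpace Y] [PseudoMetricSpace X]
    [PseudoMetricSpace Z] {f : Y → X → Z} (hf : ∀ y a b, dist (f y a) (f y b) ≤ dist a b) :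
    IsClosed {a | Continuous fun y => f y a} := by
  refine isClosed_of_closure_subset fun a ha => continuous_of_uniform_approx_of_continuous
    fun u hu => ?_
  obtain ⟨ε, hε, hεu⟩ := Metric.mem_uniformity_dist.1 hu
  obtain ⟨b, hb, hab⟩ := Metric.mem_closure_iff.1 ha ε hε
  exact ⟨fun y => f y b, hb, fun y => hεu ((hf y a b).trans_lt hab)⟩

/-! ### Unitary representations of twists -/

section Representations

variable {H : Type u} [NormedAddCommGroup H] [InnerProductSpace ℂ H] [CompleteSpace H]

theorem norm_Ad_apply (v : H ≃ₗᵢ[ℂ] H) (T : compactOps H) : ‖Ad H v T‖ = ‖T‖ :=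
  NonUnitalStarAlgHom.norm_map v.conjStarAlgEquiv v.conjStarAlgEquiv.injective (T : H →L[ℂ] H)

/-- The operators with norm continuous orbit form a closed subspace. It contains the rank one
operators, as $\mathrm{Ad}\,v(|x\rangle\langle y|)=|vx\rangle\langle vy|$, and these span a dense
subspace. -/
theorem continuous_Ad_apply {Y : Type*} [TopologicalSpace Y] {v : Y → H ≃ₗᵢ[ℂ] H}
    (hv : ∀ x, Continuous fun y => v y x) (T : compactOps H) :
    Continuous fun y => Ad H (v y) T := by
  let S : Submodule ℂ (compactOps H) :=
    { carrier := {T | Continuous fun y => Ad H (v y) T}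
      add_mem' := fun {S T} hS hT => by
        simpa only [Set.mem_ofPred_eq, map_add] using Continuous.fun_add hS hT
      zero_mem' := by simpa only [Set.mem_ofPred_eq, map_zero] using continuous_const
      smul_mem' := fun c T hT => by
        simpa only [Set.mem_ofPred_eq, map_smul] using Continuous.fun_const_smul hT c }
  have hS : IsClosed (S : Set (compactOps H)) := isClosed_setOf_continuous_apply fun y a b => by
    rw [dist_eq_norm, dist_eq_norm, ← map_sub, norm_Ad_apply]
  have hle : Submodule.span ℂ (Set.range fun p : H × H => rankOneOp p.1 p.2) ≤ S := by
    refine Submodule.span_le.2 ?_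
    rintro _ ⟨p, rfl⟩
    change Continuous fun y => Ad H (v y) (rankOneOp p.1 p.2)
    simp only [Ad_rankOneOp]
    exact continuous_rankOneOp.comp ((hv _).prodMk (hv _))
  exact hS.closure_subset_iff.2 hle (dense_span_rankOneOp T)

variable {G : Type u} [Group G] [TopologicalSpace G]

theorem Twist.continuous_descendAd (E : Twist G) (ρ : E.carrier →* (H ≃ₗᵢ[ℂ] H))
    (hρ : ∀ z, ρ (E.ι z) = scalarUnitary H z) (hc : ∀ x, Continuous fun y => ρ y x)
    (T : compactOps H) : Continuous fun g => E.descendAd ρ hρ g T := by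
  rw [E.isTwist.isOpenQuotientMap_q.isQuotientMap.continuous_iff]
  have : (fun g => E.descendAd ρ hρ g T) ∘ E.q = fun y => Ad H (ρ y) T :=
    funext fun y => by rw [Function.comp_apply, E.descendAd_q]
  rw [this]
  exact continuous_Ad_apply hc T

variable [IsTopologicalGroup G] [LocallyCompactSpace G] [T2Space G]

/-- The map $y\mapsto(q(y),\rho(y))$ is a continuous morphism of twists, hence an equivalence. -/
theorem Twist.equivalent_twist (E : Twist G) (a : CompactAction G)
    (ρ : E.carrier →* (a.H ≃ₗᵢ[ℂ] a.H)) (hι : ∀ z, ρ (E.ι z) = scalarUnitary a.H z)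
    (hc : ∀ x, Continuous fun y => ρ y x) (ha : ∀ y, a.α (E.q y) = Ad a.H (ρ y)) :
    E.Equivalent a.twist := by
  let φ : E.carrier →* a.twist.carrier :=
    { toFun := fun y => ⟨(E.q y, ρ y), ha y⟩
      map_one' := Subtype.ext (Prod.ext (map_one E.q) (map_one ρ))
      map_mul' := fun x y => Subtype.ext (Prod.ext (map_mul E.q x y) (map_mul ρ x y)) }
  refine Twist.equivalent_of_continuous φ ?_ (fun z => Subtype.ext (Prod.ext ?_ (hι z)))
    fun x => rfl
  · exact a.continuous_extension_iff.2 ⟨E.isTwist.isOpenQuotientMap_q.continuous, hc⟩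
  · change E.ι z ∈ E.q.ker
    rw [E.isTwist.ker_q]
    exact ⟨z, rfl⟩

end Representations

/-! ### Continuity of the modular function -/

section Modular

variable {G : Type u} [Group G] [TopologicalSpace G] [IsTopologicalGroup G]
  [LocallyCompactSpace G] [T2Space G]

/-- For a bump function $f\ge0$ with $f(1)=1$ one has $\Delta(h)=\int f(g)\,dg\,/\int f(gh)\,dg$.
The denominator never vanishes and is continuous, because for $h$ in a compact set $t$ the
integrands are supported in the compact set $\operatorname{supp}(f)\,t^{-1}$. -/
theorem continuous_modularFn : Continuous (modularFn : G → ℝ) := by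
  borelize G
  let μ : Measure G := Measure.haar
  obtain ⟨f, hf1, -, hfc, hf0⟩ := exists_continuous_one_zero_of_isCompact
    (isCompact_singleton (x := (1 : G))) isClosed_empty (Set.disjoint_empty _)
  have hc : 0 < ∫ g, f g ∂μ :=
    f.continuous.integral_pos_of_hasCompactSupport_nonneg_nonzero (x := 1) hfc
      (fun x => (hf0 x).1) (by rw [hf1 rfl]; exact one_ne_zero)
  have hF : Continuous fun h => ∫ g, f (g * h) ∂μ := by
    refine continuous_iff_continuousAt.2 fun h => ?_
    obtain ⟨t, ht, hth⟩ := exists_compact_mem_nhds h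
    refine ContinuousOn.continuousAt (s := t) ?_ hth
    refine continuousOn_integral_of_compact_support (hfc.isCompact.mul ht.inv) ?_ ?_
    · exact (f.continuous.comp (continuous_snd.mul continuous_fst)).continuousOn
    · intro p x hp hx
      contrapose! hx
      exact ⟨x * p, subset_tsupport _ hx, p⁻¹, Set.inv_mem_inv.2 hp, by simp⟩
  have hmul : ∀ h, modularFn h * ∫ g, f (g * h) ∂μ = ∫ g, f g ∂μ := fun h =>
    modularFn_mul_integral μ h f.continuous hfc
  have hne : ∀ h, ∫ g, f (g * h) ∂μ ≠ 0 := fun h h0 => by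
    have := hmul h
    rw [h0, mul_zero] at this
    exact hc.ne this
  have : (modularFn : G → ℝ) = fun h => (∫ g, f g ∂μ) / ∫ g, f (g * h) ∂μ :=
    funext fun h => eq_div_of_mul_eq (hne h) (hmul h)
  rw [this]
  exact continuous_const.div hF hne

end Modular

/-! ### The regular representation of a twist -/

section Regular

variable {G : Type u} [Group G] [TopologicalSpace G]

/-- The space `C_c(E, ι)` is nonzero. -/
theorem Twist.exists_ccSubmodule_ne_zero (E : Twist G) : ∃ f ∈ E.ccSubmodule, f 1 ≠ 0 := by
  have := E.isTwist.isTopologicalGroup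
  have := E.isTwist.locallyCompactSpace
  have := E.isTwist.t2Space
  have hι := E.isTwist.isEmbedding_ι
  borelize Circle
  let ν : Measure Circle := Measure.haar
  -- $U$ meets the circle in the half where $\operatorname{Re}z>0$. A bump function at $1$ vanishing
  -- off $U$ then cannot cancel when it is averaged against $\bar z$.
  obtain ⟨U, hU, hUι⟩ := hι.isInducing.isOpen_iff.1
    (isOpen_lt continuous_const (Complex.continuous_re.comp continuous_subtype_val) :
      IsOpen {z : Circle | 0 < (z : ℂ).re})
  have h1U : (1 : E.carrier) ∈ U := by
    have : (1 : Circle) ∈ E.ι ⁻¹' U := by rw [hUι]; simp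
    simpa using this
  obtain ⟨φ, hφ1, hφU, hφc, hφ0⟩ := exists_continuous_one_zero_of_isCompact
    (isCompact_singleton (x := (1 : E.carrier))) hU.isClosed_compl
    (by simpa using h1U)
  have hpos : ∀ z : Circle, 0 ≤ (z : ℂ).re * φ (E.ι z) := fun z => by
    by_cases hz : E.ι z ∈ U
    · exact mul_nonneg (le_of_lt (by simpa using hUι.subset hz)) (hφ0 _).1
    · rw [hφU hz]; simp
  have hjoint : Continuous fun p : E.carrier × Circle =>
      conj (p.2 : ℂ) * (φ (p.1 * E.ι p.2) : ℂ) := by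
    have := hι.continuous
    exact (Complex.continuous_conj.comp (continuous_subtype_val.comp continuous_snd)).mul
      (Complex.continuous_ofReal.comp
        (φ.continuous.comp (continuous_fst.mul (this.comp continuous_snd))))
  -- Projection of $\varphi$ onto the functions with $f(x\,\iota(z))=zf(x)$, by averaging over
  -- $\mathbb T$; equivariance is the invariance of Haar measure under $z\mapsto wz$.
  refine ⟨fun x => ∫ z : Circle, conj (z : ℂ) * (φ (x * E.ι z) : ℂ) ∂ν, ⟨?_, ?_, fun x w => ?_⟩, ?_⟩
  · rw [← continuousOn_univ]
    exact continuousOn_integral_of_compact_support isCompact_univ hjoint.continuousOn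
      fun p x _ hx => absurd (Set.mem_univ x) hx
  · refine HasCompactSupport.intro (hφc.isCompact.mul (isCompact_range hι.continuous))
      fun x hx => ?_
    refine integral_eq_zero_of_ae (Eventually.of_forall fun z => ?_)
    have : φ (x * E.ι z) = 0 := by
      contrapose! hx
      exact ⟨x * E.ι z, subset_tsupport _ hx, E.ι z⁻¹, ⟨z⁻¹, rfl⟩, by simp⟩
    simp [this]
  · change ∫ z : Circle, conj (z : ℂ) * (φ (x * E.ι w * E.ι z) : ℂ) ∂ν =
      w * ∫ z : Circle, conj (z : ℂ) * (φ (x * E.ι z) : ℂ) ∂ν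
    rw [← integral_const_mul, ← integral_mul_left_eq_self (μ := ν)
      (fun z : Circle => (w : ℂ) * (conj (z : ℂ) * (φ (x * E.ι z) : ℂ))) w]
    refine integral_congr_ae (Eventually.of_forall fun z => ?_)
    have hw : (w : ℂ) * conj (w : ℂ) = 1 := by
      rw [Complex.mul_conj, Circle.normSq_coe]; simp
    simp only [Circle.coe_mul, map_mul, mul_assoc]
    linear_combination (-(conj (z : ℂ) * (φ (x * (E.ι w * E.ι z)) : ℂ))) * hw
  · have hc : Continuous fun z : Circle => conj (z : ℂ) * (φ (1 * E.ι z) : ℂ) :=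
      hjoint.comp (Continuous.prodMk continuous_const continuous_id)
    have hint : Integrable (fun z : Circle => conj (z : ℂ) * (φ (1 * E.ι z) : ℂ)) ν :=
      hc.integrable_of_hasCompactSupport (HasCompactSupport.of_compactSpace _)
    have hre : (fun z : Circle => (conj (z : ℂ) * (φ (1 * E.ι z) : ℂ)).re) =
        fun z : Circle => (z : ℂ).re * φ (E.ι z) := by
      ext z
      simp
    have hlt : 0 < ∫ z : Circle, (z : ℂ).re * φ (E.ι z) ∂ν := by
      refine Continuous.integral_pos_of_hasCompactSupport_nonneg_nonzero (x := 1) ?_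
        (HasCompactSupport.of_compactSpace _) hpos ?_
      · rw [← hre]
        exact Complex.continuous_re.comp hc
      · rw [map_one, hφ1 rfl]
        simp
    intro h0
    have h2 := integral_re hint
    simp only [RCLike.re_to_complex] at h2
    rw [hre] at h2
    change ∫ z : Circle, conj (z : ℂ) * (φ (1 * E.ι z) : ℂ) ∂ν = 0 at h0
    rw [h0] at h2
    exact hlt.ne' (by simpa using h2)

variable [IsTopologicalGroup G] [LocallyCompactSpace G] [T2Space G]
  [MeasurableSpace G] [BorelSpace G] (μ : Measure G) [μ.IsHaarMeasure] (E : Twist G)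

/-- A function of $C_c(\tilde G,\iota)$ with nonzero value at $1$ has positive norm: $|\xi|^2$
descends to a continuous function on $G$, and Haar measure charges open sets. -/
theorem nontrivial_twistedL2 : Nontrivial (TwistedL2 μ E) := by
  obtain ⟨f, hf, hf1⟩ := E.exists_ccSubmodule_ne_zero
  let ξ : TwistedCc μ E := ⟨f, hf⟩
  refine ⟨TwistedL2.incl μ ξ, 0, fun h => ?_⟩
  have h0 : ‖ξ‖ = 0 := by
    rw [← UniformSpace.Completion.norm_coe ξ]
    exact norm_eq_zero.2 h
  have h1 := TwistedCc.norm_sq ξ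
  have h2 : ∀ g, ‖ξ (TwistedCc.sec E g)‖ ^ 2 = (TwistedCc.pairing ξ ξ g).re := fun g => by
    rw [TwistedCc.pairing, mul_comm, Complex.mul_conj, Complex.ofReal_re,
      Complex.normSq_eq_norm_sq]
  have h3 : 0 < ∫ g, (TwistedCc.pairing ξ ξ g).re ∂μ := by
    refine Continuous.integral_pos_of_hasCompactSupport_nonneg_nonzero (x := 1)
      (Complex.continuous_re.comp (TwistedCc.continuous_pairing ξ ξ))
      ((TwistedCc.hasCompactSupport_pairing ξ ξ).comp_left (g := Complex.re) rfl)
      (fun g => ?_) ?_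
    · rw [← h2]
      exact sq_nonneg _
    · rw [← map_one E.q, TwistedCc.pairing_q, mul_comm, Complex.mul_conj, Complex.ofReal_re]
      exact fun h => hf1 (Complex.normSq_eq_zero.1 h)
  rw [h0] at h1
  simp only [h2] at h1
  norm_num at h1
  exact h3.ne h1

/-- Weak continuity of $\tilde\rho$: the integrand is jointly continuous, and for every $y$ it is
supported in the compact set $q(\operatorname{supp}\eta)$. -/
theorem TwistedCc.continuous_inner_translate (ξ η : TwistedCc μ E) :
    Continuous fun y : E.carrier => inner ℂ (TwistedCc.translate y ξ) η := by
  have := E.isTwist.isTopologicalGroup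
  have hq := E.isTwist.isOpenQuotientMap_q
  simp only [TwistedCc.inner_def]
  rw [← continuousOn_univ]
  refine continuousOn_integral_of_compact_support
    (k := E.q '' tsupport η) (η.hasCompactSupport_coe.isCompact.image hq.continuous) ?_ ?_
  · refine Continuous.continuousOn ?_
    -- Continuity in $(y,g)$ can be tested upstairs on $\tilde G\times\tilde G$, where the integrand
    -- is explicit; the section `sec` itself need not be continuous.
    have hp := IsOpenQuotientMap.prodMap (IsOpenQuotientMap.id (X := E.carrier)) hq
    rw [hp.isQuotientMap.continuous_iff]
    have : (Function.uncurry fun (y : E.carrier) g =>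
        TwistedCc.pairing (TwistedCc.translate y ξ) η g) ∘ Prod.map id E.q =
        fun p : E.carrier × E.carrier =>
          conj ((√(modularFn (E.q p.1)) : ℂ) * ξ (p.2 * p.1)) * η p.2 := by
      ext p
      exact TwistedCc.pairing_q _ _ _
    rw [this]
    refine (Complex.continuous_conj.comp (Continuous.mul ?_ ?_)).mul
      (η.continuous_coe.comp continuous_snd)
    · exact Complex.continuous_ofReal.comp (Real.continuous_sqrt.comp
        (continuous_modularFn.comp (hq.continuous.comp continuous_fst)))
    · exact ξ.continuous_coe.comp (continuous_snd.mul continuous_fst)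
  · intro y g _ hg
    have : η (TwistedCc.sec E g) = 0 := by
      contrapose! hg
      exact ⟨TwistedCc.sec E g, subset_tsupport _ hg, TwistedCc.q_sec g⟩
    rw [TwistedCc.pairing, this, mul_zero]

/-- For unitaries weak continuity gives strong continuity:
$\|\tilde\rho(y)\xi-\tilde\rho(y_0)\xi\|^2=2\|\xi\|^2-2\operatorname{Re}\langle\tilde\rho(y)\xi,\tilde\rho(y_0)\xi\rangle$.
By density $\xi\in C_c(\tilde G,\iota)$ suffices. -/
theorem continuous_regularRep (x : TwistedL2 μ E) : Continuous fun y => regularRep μ E y x := by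
  have hclosed := isClosed_setOf_continuous_apply
    (f := fun (y : E.carrier) (x : TwistedL2 μ E) => regularRep μ E y x)
    fun y a b => ((regularRep μ E y).dist_map a b).le
  suffices h : ∀ ξ : TwistedCc μ E, Continuous fun y => regularRep μ E y (TwistedL2.incl μ ξ) from
    hclosed.closure_subset_iff.2 (Set.range_subset_iff.2 h) (TwistedL2.denseRange_incl x)
  intro ξ
  have hrep : ∀ y, regularRep μ E y (TwistedL2.incl μ ξ) =
      TwistedL2.incl μ (TwistedCc.translate y ξ) := fun y => regularUnitary_incl μ y ξ
  refine continuous_iff_continuousAt.2 fun y₀ => ?_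
  rw [ContinuousAt, tendsto_iff_norm_sub_tendsto_zero]
  have hsq : Tendsto (fun y => ‖regularRep μ E y (TwistedL2.incl μ ξ) -
      regularRep μ E y₀ (TwistedL2.incl μ ξ)‖ ^ 2) (𝓝 y₀) (𝓝 0) := by
    have h1 : ∀ y, ‖regularRep μ E y (TwistedL2.incl μ ξ) -
        regularRep μ E y₀ (TwistedL2.incl μ ξ)‖ ^ 2 =
        ‖ξ‖ ^ 2 - 2 * (inner ℂ (TwistedCc.translate y ξ) (TwistedCc.translate y₀ ξ)).re +
          ‖ξ‖ ^ 2 := fun y => by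
      rw [hrep, hrep, ← map_sub]
      change ‖((TwistedCc.translate y ξ - TwistedCc.translate y₀ ξ : TwistedCc μ E) :
        TwistedL2 μ E)‖ ^ 2 = _
      rw [UniformSpace.Completion.norm_coe, @norm_sub_sq ℂ, TwistedCc.norm_translate,
        TwistedCc.norm_translate]
      rfl
    simp only [h1]
    have h2 := (Complex.continuous_re.comp
      (TwistedCc.continuous_inner_translate μ E ξ (TwistedCc.translate y₀ ξ))).tendsto y₀
    have h3 := (tendsto_const_nhds (x := ‖ξ‖ ^ 2) |>.sub (h2.const_mul 2)).add
      (tendsto_const_nhds (x := ‖ξ‖ ^ 2))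
    refine h3.trans_eq (congrArg 𝓝 ?_)
    have h4 := inner_self_eq_norm_sq (𝕜 := ℂ) (TwistedCc.translate y₀ ξ)
    rw [TwistedCc.norm_translate] at h4
    change ‖ξ‖ ^ 2 - 2 * (inner ℂ (TwistedCc.translate y₀ ξ) (TwistedCc.translate y₀ ξ)).re + _ = 0
    change (inner ℂ (TwistedCc.translate y₀ ξ) (TwistedCc.translate y₀ ξ)).re = _ at h4
    rw [h4]
    ring
  have := (Real.continuous_sqrt.tendsto 0).comp hsq
  simpa [Function.comp_def, Real.sqrt_sq] using this

theorem regularHom_isAction : (regularHom μ E).IsAction where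
  nontrivial := nontrivial_twistedL2 μ E
  continuous := E.continuous_descendAd (regularRep μ E) (regularRep_ι μ E)
    (continuous_regularRep μ E)

/-- The action on `𝒦(L²(E, ι))` associated with a twist `E`. -/
noncomputable def regularAction : CompactAction G := ⟨regularHom μ E, regularHom_isAction μ E⟩

theorem Twist.equivalent_twist_regularAction : E.Equivalent (regularAction μ E).twist :=
  E.equivalent_twist (regularAction μ E) (regularRep μ E) (regularRep_ι μ E)
    (continuous_regularRep μ E) (regularHom_q μ E)

end Regular

/-! ### The equivalence bimodule of compact maps between two Hilbert spaces -/

section CompactBimodule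

/-- The square root of a positive compact operator is compact, since the non-unital functional
calculus stays in a closed star subalgebra. -/
theorem exists_star_mul_self_of_isPositive {H : Type u} [NormedAddCommGroup H]
    [InnerProductSpace ℂ H] [CompleteSpace H] (P : compactOps H)
    (hP : (P : H →L[ℂ] H).IsPositive) : ∃ c : compactOps H, P = star c * c := by
  have h0 : 0 ≤ (P : H →L[ℂ] H) := (ContinuousLinearMap.nonneg_iff_isPositive _).2 hP
  have hmem : CFC.sqrt (P : H →L[ℂ] H) ∈ compactOps H := by
    rw [CFC.sqrt_eq_real_sqrt _ h0]
    exact cfcₙ_mem _ P.2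
  refine ⟨⟨_, hmem⟩, Subtype.ext ?_⟩
  change _ = star (CFC.sqrt (P : H →L[ℂ] H)) * CFC.sqrt (P : H →L[ℂ] H)
  rw [(CFC.sqrt_nonneg (P : H →L[ℂ] H)).isSelfAdjoint.star_eq, CFC.sqrt_mul_sqrt_self _ h0]

variable (H K : Type u) [NormedAddCommGroup H] [InnerProductSpace ℂ H] [CompleteSpace H]
  [NormedAddCommGroup K] [InnerProductSpace ℂ K] [CompleteSpace K]

/-- The Banach space `𝒦(H, K)` of compact operators between Hilbert spaces. -/
abbrev CompactMaps : Type u := compactOperator (RingHom.id ℂ) H K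

instance : CompleteSpace (CompactMaps H K) :=
  (isClosed_setOfPred_isCompactOperator (σ₁₂ := RingHom.id ℂ) (M₁ := H)
    (M₂ := K)).completeSpace_coe

open ContinuousLinearMap in
/-- The `𝒦(K)`-`𝒦(H)` equivalence bimodule `𝒦(H, K)`. -/
noncomputable def compactBimodule [Nontrivial H] [Nontrivial K] :
    EquivalenceBimodule (compactOps K) (compactOps H) (CompactMaps H K) where
  lsmul := LinearMap.mk₂ ℂ (fun a x => ⟨(a : K →L[ℂ] K) ∘L x, a.2.comp_clm x.1⟩)
    (fun _ _ _ => Subtype.ext (add_comp _ _ _)) (fun _ _ _ => Subtype.ext (smul_comp _ _ _))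
    (fun _ _ _ => Subtype.ext (comp_add _ _ _)) (fun _ _ _ => Subtype.ext (comp_smul _ _ _))
  rsmul := LinearMap.mk₂ ℂ (fun b x => ⟨x.1 ∘L (b : H →L[ℂ] H), x.2.comp_clm b.1⟩)
    (fun _ _ _ => Subtype.ext (comp_add _ _ _)) (fun _ _ _ => Subtype.ext (comp_smul _ _ _))
    (fun _ _ _ => Subtype.ext (add_comp _ _ _)) (fun _ _ _ => Subtype.ext (smul_comp _ _ _))
  linner := LinearMap.mk₂'ₛₗ (RingHom.id ℂ) (starRingEnd ℂ)
    (fun x y => ⟨x.1 ∘L adjoint y.1, x.2.comp_clm _⟩)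
    (fun _ _ _ => Subtype.ext (add_comp _ _ _)) (fun _ _ _ => Subtype.ext (smul_comp _ _ _))
    (fun x y z => Subtype.ext (by simp [comp_add]))
    (fun c x y => Subtype.ext (by
      change x.1 ∘L adjoint (c • y.1) = conj c • (x.1 ∘L adjoint y.1)
      rw [map_smulₛₗ, comp_smul]))
  rinner := LinearMap.mk₂'ₛₗ (starRingEnd ℂ) (RingHom.id ℂ)
    (fun x y => ⟨adjoint x.1 ∘L y.1, y.2.clm_comp (adjoint x.1)⟩)
    (fun x y z => Subtype.ext (by simp [add_comp]))
    (fun c x y => Subtype.ext (by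
      change adjoint (c • x.1) ∘L y.1 = conj c • (adjoint x.1 ∘L y.1)
      rw [map_smulₛₗ, smul_comp]))
    (fun _ _ _ => Subtype.ext (comp_add _ _ _)) (fun _ _ _ => Subtype.ext (comp_smul _ _ _))
  mul_lsmul _ _ _ := rfl
  mul_rsmul _ _ _ := rfl
  lsmul_rsmul _ _ _ := rfl
  star_linner x y := Subtype.ext <| by
    change adjoint (x.1 ∘L adjoint y.1) = y.1 ∘L adjoint x.1
    rw [adjoint_comp, adjoint_adjoint]
  star_rinner x y := Subtype.ext <| by
    change adjoint (adjoint x.1 ∘L y.1) = adjoint y.1 ∘L x.1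
    rw [adjoint_comp, adjoint_adjoint]
  linner_lsmul _ _ _ := rfl
  rinner_rsmul _ _ _ := rfl
  linner_self_nonneg x := exists_star_mul_self_of_isPositive _ (isPositive_self_comp_adjoint x.1)
  rinner_self_nonneg x := exists_star_mul_self_of_isPositive _ (isPositive_adjoint_comp_self x.1)
  norm_linner_self x := by
    change ‖x.1 ∘L adjoint x.1‖ = ‖x.1‖ ^ 2
    have h := norm_adjoint_comp_self (adjoint x.1)
    rw [adjoint_adjoint, LinearIsometryEquiv.norm_map] at h
    rw [h, sq]
  norm_rinner_self x := by
    change ‖adjoint x.1 ∘L x.1‖ = ‖x.1‖ ^ 2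
    rw [norm_adjoint_comp_self, sq]
  rinner_lsmul a x y := Subtype.ext <| by
    change adjoint (a.1 ∘L x.1) ∘L y.1 = adjoint x.1 ∘L (adjoint a.1 ∘L y.1)
    rw [adjoint_comp, comp_assoc]
  linner_rsmul b x y := Subtype.ext <| by
    change (x.1 ∘L b.1) ∘L adjoint y.1 = x.1 ∘L adjoint (y.1 ∘L adjoint b.1)
    rw [adjoint_comp, adjoint_adjoint, comp_assoc]
  linner_lsmul_eq_rinner_rsmul _ _ _ := rfl
  left_full := by
    -- For a unit vector $\xi$, $|x\rangle\langle\xi|\,(|y\rangle\langle\xi|)^*=|x\rangle\langle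
    -- y|$, so all rank one operators are inner products.
    obtain ⟨ξ, hξ⟩ := exists_norm_eq H (zero_le_one (α := ℝ))
    refine dense_span_rankOneOp.mono (Submodule.span_mono ?_)
    rintro _ ⟨p, rfl⟩
    refine ⟨⟨rankOne ℂ p.1 ξ, isCompactOperator_rankOne _ _⟩,
      ⟨rankOne ℂ p.2 ξ, isCompactOperator_rankOne _ _⟩, Subtype.ext ?_⟩
    change rankOne ℂ p.1 ξ ∘L adjoint (rankOne ℂ p.2 ξ) = rankOne ℂ p.1 p.2
    rw [adjoint_rankOne, rankOne_comp_rankOne, inner_self_eq_norm_sq_to_K, hξ]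
    simp
  right_full := by
    obtain ⟨ξ, hξ⟩ := exists_norm_eq K (zero_le_one (α := ℝ))
    refine dense_span_rankOneOp.mono (Submodule.span_mono ?_)
    rintro _ ⟨p, rfl⟩
    refine ⟨⟨rankOne ℂ ξ p.1, isCompactOperator_rankOne _ _⟩,
      ⟨rankOne ℂ ξ p.2, isCompactOperator_rankOne _ _⟩, Subtype.ext ?_⟩
    change adjoint (rankOne ℂ ξ p.1) ∘L rankOne ℂ ξ p.2 = rankOne ℂ p.1 p.2
    rw [adjoint_rankOne, rankOne_comp_rankOne, inner_self_eq_norm_sq_to_K, hξ]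
    simp

variable {H K}

/-- The linear map `T ↦ u T v*` on `𝒦(H, K)` for unitaries `u`, `v`. -/
noncomputable def conjCompact : (K ≃ₗᵢ[ℂ] K) × (H ≃ₗᵢ[ℂ] H) →*
    (CompactMaps H K ≃ₗ[ℂ] CompactMaps H K) where
  toFun p :=
    { toFun := fun T => ⟨(p.1 : K →L[ℂ] K) ∘L T.1 ∘L (p.2.symm : H →L[ℂ] H),
        (T.2.comp_clm (p.2.symm : H →L[ℂ] H)).clm_comp (p.1 : K →L[ℂ] K)⟩
      invFun := fun T => ⟨(p.1.symm : K →L[ℂ] K) ∘L T.1 ∘L (p.2 : H →L[ℂ] H),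
        (T.2.comp_clm (p.2 : H →L[ℂ] H)).clm_comp (p.1.symm : K →L[ℂ] K)⟩
      left_inv := fun T => by ext; simp
      right_inv := fun T => by ext; simp
      map_add' := fun S T => by ext; simp
      map_smul' := fun c T => by ext; simp }
  map_one' := by ext; rfl
  map_mul' p p' := by ext; rfl

theorem conjCompact_apply (p : (K ≃ₗᵢ[ℂ] K) × (H ≃ₗᵢ[ℂ] H)) (T : CompactMaps H K) (x : H) :
    (conjCompact p T).1 x = p.1 (T.1 (p.2.symm x)) := rfl

theorem norm_conjCompact_apply (p : (K ≃ₗᵢ[ℂ] K) × (H ≃ₗᵢ[ℂ] H)) (T : CompactMaps H K) :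
    ‖conjCompact p T‖ = ‖T‖ := by
  have h : ∀ (p : (K ≃ₗᵢ[ℂ] K) × (H ≃ₗᵢ[ℂ] H)) T, ‖conjCompact p T‖ ≤ ‖T‖ := fun p T =>
    ContinuousLinearMap.opNorm_le_bound _ (norm_nonneg _) fun x => by
      change ‖p.1 (T.1 (p.2.symm x))‖ ≤ _
      rw [p.1.norm_map, ← p.2.symm.norm_map x]
      exact T.1.le_opNorm _
  refine (h p T).antisymm ?_
  have h1 := h p⁻¹ (conjCompact p T)
  rwa [← LinearEquiv.mul_apply, ← map_mul, inv_mul_cancel, map_one] at h1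

theorem conjCompact_rankOne (p : (K ≃ₗᵢ[ℂ] K) × (H ≃ₗᵢ[ℂ] H)) (x : K) (y : H) :
    conjCompact p ⟨rankOne ℂ x y, isCompactOperator_rankOne x y⟩ =
      ⟨rankOne ℂ (p.1 x) (p.2 y), isCompactOperator_rankOne _ _⟩ := by
  refine Subtype.ext (ContinuousLinearMap.ext fun z => ?_)
  rw [conjCompact_apply, rankOne_apply, rankOne_apply, map_smul, ← p.2.inner_map_map,
    p.2.apply_symm_apply]

/-- The argument is that of `continuous_Ad_apply`: reduction to rank one operators, where
$u|x\rangle\langle y|v^*=|ux\rangle\langle vy|$. -/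
theorem continuous_conjCompact_apply {Y : Type*} [TopologicalSpace Y] {u : Y → K ≃ₗᵢ[ℂ] K}
    {v : Y → H ≃ₗᵢ[ℂ] H} (hu : ∀ x, Continuous fun y => u y x)
    (hv : ∀ x, Continuous fun y => v y x) (T : CompactMaps H K) :
    Continuous fun y => conjCompact (u y, v y) T := by
  let S : Submodule ℂ (CompactMaps H K) :=
    { carrier := {T | Continuous fun y => conjCompact (u y, v y) T}
      add_mem' := fun {S T} hS hT => by
        simpa only [Set.mem_ofPred_eq, map_add] using Continuous.fun_add hS hT
      zero_mem' := by simpa only [Set.mem_ofPred_eq, map_zero] using continuous_const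
      smul_mem' := fun c T hT => by
        simpa only [Set.mem_ofPred_eq, map_smul] using Continuous.fun_const_smul hT c }
  have hS : IsClosed (S : Set (CompactMaps H K)) := isClosed_setOf_continuous_apply fun y a b => by
    rw [dist_eq_norm, dist_eq_norm, ← map_sub]
    exact (norm_conjCompact_apply (u y, v y) (a - b)).le
  let R : Set (CompactMaps H K) := Set.range fun p : K × H =>
    ⟨rankOne ℂ p.1 p.2, isCompactOperator_rankOne p.1 p.2⟩
  have hle : Submodule.span ℂ R ≤ S := by
    refine Submodule.span_le.2 ?_
    rintro _ ⟨p, rfl⟩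
    change Continuous fun y => conjCompact (u y, v y) _
    simp only [conjCompact_rankOne]
    have h : Continuous fun p : K × H => rankOne ℂ p.1 p.2 :=
      (ContinuousLinearMap.smulRightL ℂ H K).continuous₂.comp
        (((innerSL ℂ (E := H)).continuous.comp continuous_snd).prodMk continuous_fst)
    exact Topology.IsInducing.subtypeVal.continuous_iff.2 (h.comp ((hu p.1).prodMk (hv p.2)))
  refine hS.closure_subset_iff.2 hle ?_
  rw [Topology.IsEmbedding.subtypeVal.closure_eq_preimage_closure_image, Set.mem_preimage]
  convert mem_closure_span_rankOne T.2 using 2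
  have := Submodule.map_span (compactOperator (RingHom.id ℂ) H K).subtype R
  rw [← Set.range_comp] at this
  exact congrArg SetLike.coe this

theorem adjoint_conjCompact (p : (K ≃ₗᵢ[ℂ] K) × (H ≃ₗᵢ[ℂ] H)) (T : CompactMaps H K) (x : K) :
    ContinuousLinearMap.adjoint (conjCompact p T).1 x =
      p.2 (ContinuousLinearMap.adjoint T.1 (p.1.symm x)) := by
  refine ext_inner_right ℂ fun y => ?_
  rw [ContinuousLinearMap.adjoint_inner_left, conjCompact_apply, ← p.2.symm.inner_map_map,
    p.2.symm_apply_apply, ContinuousLinearMap.adjoint_inner_left,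
    ← p.1.inner_map_map (p.1.symm x), p.1.apply_symm_apply]

variable [Nontrivial H] [Nontrivial K]

theorem conjCompact_lsmul (p : (K ≃ₗᵢ[ℂ] K) × (H ≃ₗᵢ[ℂ] H)) (S : compactOps K)
    (T : CompactMaps H K) : conjCompact p ((compactBimodule H K).lsmul S T) =
      (compactBimodule H K).lsmul (Ad K p.1 S) (conjCompact p T) := by
  refine Subtype.ext (ContinuousLinearMap.ext fun z => ?_)
  change p.1 (S.1 (T.1 (p.2.symm z))) = p.1 (S.1 (p.1.symm (p.1 (T.1 (p.2.symm z)))))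
  rw [LinearIsometryEquiv.symm_apply_apply]

theorem conjCompact_rsmul (p : (K ≃ₗᵢ[ℂ] K) × (H ≃ₗᵢ[ℂ] H)) (S : compactOps H)
    (T : CompactMaps H K) : conjCompact p ((compactBimodule H K).rsmul S T) =
      (compactBimodule H K).rsmul (Ad H p.2 S) (conjCompact p T) := by
  refine Subtype.ext (ContinuousLinearMap.ext fun z => ?_)
  change p.1 (T.1 (S.1 (p.2.symm z))) = p.1 (T.1 (p.2.symm (p.2 (S.1 (p.2.symm z)))))
  rw [LinearIsometryEquiv.symm_apply_apply]

theorem linner_conjCompact (p : (K ≃ₗᵢ[ℂ] K) × (H ≃ₗᵢ[ℂ] H)) (S T : CompactMaps H K) :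
    (compactBimodule H K).linner (conjCompact p S) (conjCompact p T) =
      Ad K p.1 ((compactBimodule H K).linner S T) := by
  refine compactOps_ext fun z => ?_
  change (conjCompact p S).1 (ContinuousLinearMap.adjoint (conjCompact p T).1 z) =
    p.1 (S.1 (ContinuousLinearMap.adjoint T.1 (p.1.symm z)))
  rw [adjoint_conjCompact, conjCompact_apply, LinearIsometryEquiv.symm_apply_apply]

theorem rinner_conjCompact (p : (K ≃ₗᵢ[ℂ] K) × (H ≃ₗᵢ[ℂ] H)) (S T : CompactMaps H K) :
    (compactBimodule H K).rinner (conjCompact p S) (conjCompact p T) =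
      Ad H p.2 ((compactBimodule H K).rinner S T) := by
  refine compactOps_ext fun z => ?_
  change ContinuousLinearMap.adjoint (conjCompact p S).1 ((conjCompact p T).1 z) =
    p.2 (ContinuousLinearMap.adjoint S.1 (T.1 (p.2.symm z)))
  rw [adjoint_conjCompact, conjCompact_apply, LinearIsometryEquiv.symm_apply_apply]

end CompactBimodule

/-! ### From equivalent twists to Morita equivalent actions -/

section MoritaOfEquivalent

variable {G : Type u} [Group G] [TopologicalSpace G] [IsTopologicalGroup G]
  [LocallyCompactSpace G] [T2Space G]

/-- Actions of `G` induced by unitary representations of the same twist are Morita equivalent. -/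
theorem moritaEquivalent_of_rep {a b : CompactAction G} (E : Twist G)
    (u : E.carrier →* (a.H ≃ₗᵢ[ℂ] a.H)) (v : E.carrier →* (b.H ≃ₗᵢ[ℂ] b.H))
    (hu : ∀ x, Continuous fun y => u y x) (hv : ∀ x, Continuous fun y => v y x)
    (huι : ∀ z, u (E.ι z) = scalarUnitary a.H z) (hvι : ∀ z, v (E.ι z) = scalarUnitary b.H z)
    (ha : ∀ y, a.α (E.q y) = Ad a.H (u y)) (hb : ∀ y, b.α (E.q y) = Ad b.H (v y)) :
    MoritaEquivalent a b := by
  have := a.isAction.nontrivial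
  have := b.isAction.nontrivial
  have hsurj := E.isTwist.isOpenQuotientMap_q.surjective
  obtain ⟨γ, hγ⟩ : ∃ γ : G →* (CompactMaps b.H a.H ≃ₗ[ℂ] CompactMaps b.H a.H),
      ∀ y T, γ (E.q y) T = conjCompact (u y, v y) T := by
    refine ⟨E.q.liftOfSurjective hsurj
      ⟨conjCompact.comp (u.prod v), ?_⟩, fun y T =>
        congrArg (fun f : CompactMaps b.H a.H ≃ₗ[ℂ] CompactMaps b.H a.H => f T)
          (MonoidHom.liftOfRightInverse_comp_apply _ _ _ _ y)⟩
    -- Scalars act trivially, since $zT\bar z=T$; so the action of the twist on $\mathcal K(\mathcal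
    -- H_\beta,\mathcal H_\alpha)$ descends to $G$.
    rw [E.isTwist.ker_q]
    rintro _ ⟨z, rfl⟩
    rw [MonoidHom.mem_ker, MonoidHom.comp_apply, MonoidHom.prod_apply, huι, hvι]
    refine LinearEquiv.ext fun T => Subtype.ext (ContinuousLinearMap.ext fun x => ?_)
    rw [conjCompact_apply, scalarUnitary_apply, ← map_smul, ← map_smul, ← scalarUnitary_apply]
    exact congrArg T.1 ((scalarUnitary b.H z).symm_apply_apply x)
  have hlsmul : ∀ y T x, γ (E.q y) ((compactBimodule b.H a.H).lsmul T x) =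
      (compactBimodule b.H a.H).lsmul (a.α (E.q y) T) (γ (E.q y) x) := fun y T x =>
    (hγ y _).trans ((conjCompact_lsmul (u y, v y) T x).trans
      (congrArg₂ (fun S z => (compactBimodule b.H a.H).lsmul S z)
        (DFunLike.congr_fun (ha y) T).symm (hγ y x).symm))
  have hrsmul : ∀ y T x, γ (E.q y) ((compactBimodule b.H a.H).rsmul T x) =
      (compactBimodule b.H a.H).rsmul (b.α (E.q y) T) (γ (E.q y) x) := fun y T x =>
    (hγ y _).trans ((conjCompact_rsmul (u y, v y) T x).trans
      (congrArg₂ (fun S z => (compactBimodule b.H a.H).rsmul S z)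
        (DFunLike.congr_fun (hb y) T).symm (hγ y x).symm))
  have hlinner : ∀ y S T, (compactBimodule b.H a.H).linner (γ (E.q y) S) (γ (E.q y) T) =
      a.α (E.q y) ((compactBimodule b.H a.H).linner S T) := fun y S T =>
    (congrArg₂ (fun S T => (compactBimodule b.H a.H).linner S T) (hγ y S) (hγ y T)).trans
      ((linner_conjCompact (u y, v y) S T).trans (DFunLike.congr_fun (ha y) _).symm)
  have hrinner : ∀ y S T, (compactBimodule b.H a.H).rinner (γ (E.q y) S) (γ (E.q y) T) =
      b.α (E.q y) ((compactBimodule b.H a.H).rinner S T) := fun y S T =>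
    (congrArg₂ (fun S T => (compactBimodule b.H a.H).rinner S T) (hγ y S) (hγ y T)).trans
      ((rinner_conjCompact (u y, v y) S T).trans (DFunLike.congr_fun (hb y) _).symm)
  have hcont : ∀ T, Continuous fun g => γ g T := fun T => by
    rw [E.isTwist.isOpenQuotientMap_q.isQuotientMap.continuous_iff]
    have : (fun g => γ g T) ∘ E.q = fun y => conjCompact (u y, v y) T := funext fun y => hγ y T
    rw [this]
    exact continuous_conjCompact_apply hu hv T
  exact ⟨CompactMaps b.H a.H, inferInstance, inferInstance, inferInstance,
    compactBimodule b.H a.H, γ, hcont, hsurj.forall.2 hlsmul, hsurj.forall.2 hrsmul,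
    hsurj.forall.2 hlinner, hsurj.forall.2 hrinner⟩

/-- An equivalence $\varphi$ makes both actions come from the single twist $G_\alpha$: the unitary
component of $p$ implements $\alpha$, that of $\varphi(p)$ implements $\beta$. -/
theorem moritaEquivalent_of_twist_equivalent {a b : CompactAction G}
    (h : a.twist.Equivalent b.twist) : MoritaEquivalent a b := by
  obtain ⟨φ, hι, hq⟩ := h
  let u : a.twist.carrier →* (a.H ≃ₗᵢ[ℂ] a.H) :=
    (MonoidHom.snd G (a.H ≃ₗᵢ[ℂ] a.H)).comp a.extensionGroup.subtype
  let w : b.twist.carrier →* (b.H ≃ₗᵢ[ℂ] b.H) :=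
    (MonoidHom.snd G (b.H ≃ₗᵢ[ℂ] b.H)).comp b.extensionGroup.subtype
  refine moritaEquivalent_of_rep a.twist u (w.comp φ.toMulEquiv.toMonoidHom)
    a.continuous_extension_snd (fun x => (b.continuous_extension_snd x).comp φ.continuous)
    (fun z => rfl) (fun z => ?_) (fun p => p.2) fun p => ?_
  · exact congrArg w (hι z)
  · rw [← hq]
    exact (φ p).2

end MoritaOfEquivalent

/-! ### Corners of the compact operators -/

section RankOne

variable {H : Type u} [NormedAddCommGroup H] [InnerProductSpace ℂ H] [CompleteSpace H]

theorem rankOneOp_sub_right (x y y' : H) :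
    rankOneOp x (y - y') = rankOneOp x y - rankOneOp x y' :=
  Subtype.ext (map_sub (rankOne ℂ x) y y')

theorem rankOneOp_mul_mul_rankOneOp (T : compactOps H) (x y z w : H) :
    rankOneOp x y * T * rankOneOp z w = inner ℂ y ((T : H →L[ℂ] H) z) • rankOneOp x w := by
  rw [mul_assoc, mul_rankOneOp, rankOneOp_mul_rankOneOp]

theorem exists_unit_apply_ne_zero {T : compactOps H} (hT : T ≠ 0) :
    ∃ ξ : H, ‖ξ‖ = 1 ∧ (T : H →L[ℂ] H) ξ ≠ 0 := by
  obtain ⟨x, hx⟩ : ∃ x, (T : H →L[ℂ] H) x ≠ 0 := by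
    by_contra! h
    exact hT (compactOps_ext h)
  have hx0 : x ≠ 0 := by
    rintro rfl
    exact hx (map_zero _)
  refine ⟨((‖x‖⁻¹ : ℝ) : ℂ) • x, norm_inv_norm_smul hx0, ?_⟩
  rw [map_smul]
  exact smul_ne_zero (Complex.ofReal_ne_zero.2 (inv_ne_zero (norm_ne_zero_iff.2 hx0))) hx

theorem rankOneOp_ne_zero {x y : H} (hx : ‖x‖ = 1) (hy : ‖y‖ = 1) : rankOneOp x y ≠ 0 := fun h => by
  have h1 := norm_rankOneOp x y
  rw [h, hx, hy, norm_zero] at h1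
  norm_num at h1

/-- A positive multiple of a rank one projection of norm one is the projection. -/
theorem eq_rankOneOp_of_smul {ξ : H} (hξ : ‖ξ‖ = 1) {T : compactOps H}
    (h : rankOneOp ξ ξ * T * rankOneOp ξ ξ = T) (hT : ‖T‖ = 1) (hpos : ∃ c, T = star c * c) :
    T = rankOneOp ξ ξ := by
  rw [rankOneOp_mul_mul_rankOneOp] at h
  obtain ⟨c, rfl⟩ := hpos
  -- $T$ is the multiple of the projection by $\langle\xi,c^*c\,\xi\rangle=\|c\,\xi\|^2\ge0$, and
  -- the norm condition makes this factor $1$.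
  have h1 : inner ℂ ξ (((star c * c : compactOps H) : H →L[ℂ] H) ξ) =
      ((‖(c : H →L[ℂ] H) ξ‖ ^ 2 : ℝ) : ℂ) := by
    rw [coe_mul_apply, ← inner_star_apply, star_star, inner_self_eq_norm_sq_to_K]
    simp
  rw [h1] at h
  rw [← h, norm_smul, norm_rankOneOp, hξ, mul_one, mul_one, Complex.norm_real,
    Real.norm_of_nonneg (sq_nonneg _)] at hT
  rw [← h, hT, Complex.ofReal_one, one_smul]

end RankOne

/-! ### Norm estimates in an equivalence bimodule -/

section BimoduleNorm

namespace EquivalenceBimodule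

variable {A B X : Type*} [NonUnitalCStarAlgebra A] [NonUnitalCStarAlgebra B]
    [NormedAddCommGroup X] [NormedSpace ℂ X] [CompleteSpace X] (M : EquivalenceBimodule A B X)

theorem linner_lsmul_lsmul (a a' : A) (x y : X) :
    M.linner (M.lsmul a x) (M.lsmul a' y) = a * M.linner x y * star a' := by
  rw [M.linner_lsmul, ← M.star_linner, M.linner_lsmul, star_mul, M.star_linner, mul_assoc]

theorem rinner_rsmul_rsmul (b b' : B) (x y : X) :
    M.rinner (M.rsmul b x) (M.rsmul b' y) = star b * M.rinner x y * b' := by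
  rw [M.rinner_rsmul, ← M.star_rinner, M.rinner_rsmul, star_mul, M.star_rinner]

theorem norm_lsmul_le (a : A) (x : X) : ‖M.lsmul a x‖ ≤ ‖a‖ * ‖x‖ := by
  refine le_of_sq_le_sq ?_ (by positivity)
  rw [← M.norm_linner_self, linner_lsmul_lsmul, mul_pow, ← M.norm_linner_self x]
  refine (norm_mul_le _ _).trans ((mul_le_mul_of_nonneg_right (norm_mul_le _ _)
    (norm_nonneg _)).trans_eq ?_)
  rw [norm_star]
  ring

theorem norm_rsmul_le (b : B) (x : X) : ‖M.rsmul b x‖ ≤ ‖b‖ * ‖x‖ := by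
  refine le_of_sq_le_sq ?_ (by positivity)
  rw [← M.norm_rinner_self, rinner_rsmul_rsmul, mul_pow, ← M.norm_rinner_self x]
  refine (norm_mul_le _ _).trans ((mul_le_mul_of_nonneg_right (norm_mul_le _ _)
    (norm_nonneg _)).trans_eq ?_)
  rw [norm_star]
  ring

theorem continuous_lsmul : Continuous fun p : A × X => M.lsmul p.1 p.2 :=
  (LinearMap.mkContinuous₂ M.lsmul 1 fun a x => by
    rw [one_mul]; exact M.norm_lsmul_le a x).continuous₂

end EquivalenceBimodule

end BimoduleNorm

/-! ### One-dimensional corners of an equivalence bimodule -/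

section Corner

variable {H K X : Type u} [NormedAddCommGroup H] [InnerProductSpace ℂ H] [CompleteSpace H]
  [NormedAddCommGroup K] [InnerProductSpace ℂ K] [CompleteSpace K]
  [NormedAddCommGroup X] [NormedSpace ℂ X] [CompleteSpace X]
  (M : EquivalenceBimodule (compactOps H) (compactOps K) X)

namespace EquivalenceBimodule

/-- `x` is a unit vector in the corner `p X q` of the `𝒦(H)`-`𝒦(K)` equivalence bimodule `X`, where
`p` and `q` are the rank one projections on the lines spanned by the unit vectors `ξ` and `η`. -/
structure IsCornerUnit (ξ : H) (η : K) (x : X) : Prop where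
  norm_left : ‖ξ‖ = 1
  norm_right : ‖η‖ = 1
  norm_unit : ‖x‖ = 1
  lsmul_unit : M.lsmul (rankOneOp ξ ξ) x = x
  rsmul_unit : M.rsmul (rankOneOp η η) x = x

/-- Fullness forces $X\ne0$. If $x\ne0$, a unit vector $\xi$ not killed by the left inner product
$\langle x,x\rangle$ gives $px\ne0$. The same argument on the right gives $pxq\ne0$, which is then
normalized. -/
theorem exists_isCornerUnit [Nontrivial K] : ∃ ξ η x, M.IsCornerUnit ξ η x := by
  obtain ⟨x, hx⟩ : ∃ x : X, x ≠ 0 := by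
    by_contra! h
    obtain ⟨η, hη⟩ := exists_norm_eq K (zero_le_one (α := ℝ))
    have h1 : Submodule.span ℂ {b : compactOps K | ∃ x y, M.rinner x y = b} = ⊥ := by
      refine Submodule.span_eq_bot.2 ?_
      rintro _ ⟨x, y, rfl⟩
      rw [h y, map_zero]
    have h2 := M.right_full
    rw [h1] at h2
    have h3 := h2 (rankOneOp η η)
    rw [Submodule.bot_coe, closure_singleton] at h3
    exact rankOneOp_ne_zero hη hη h3
  have hl : M.linner x x ≠ 0 := norm_ne_zero_iff.1 (by
    rw [M.norm_linner_self]
    exact pow_ne_zero 2 (norm_ne_zero_iff.2 hx))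
  obtain ⟨ξ, hξ, hξ'⟩ := exists_unit_apply_ne_zero hl
  have hx' : M.lsmul (rankOneOp ξ ξ) x ≠ 0 := fun h0 => by
    have h1 := M.linner_lsmul (rankOneOp ξ ξ) x x
    rw [h0, map_zero, LinearMap.zero_apply] at h1
    have h2 := congrArg star h1
    rw [star_zero, star_mul, M.star_linner, star_rankOneOp, mul_rankOneOp] at h2
    have h3 := congrArg norm h2
    rw [norm_rankOneOp, hξ, mul_one, norm_zero] at h3
    exact hξ' (norm_eq_zero.1 h3.symm)
  set x' := M.lsmul (rankOneOp ξ ξ) x with hx'_def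
  have hr : M.rinner x' x' ≠ 0 := norm_ne_zero_iff.1 (by
    rw [M.norm_rinner_self]
    exact pow_ne_zero 2 (norm_ne_zero_iff.2 hx'))
  obtain ⟨η, hη, hη'⟩ := exists_unit_apply_ne_zero hr
  have hy : M.rsmul (rankOneOp η η) x' ≠ 0 := fun h0 => by
    have h1 := M.rinner_rsmul x' x' (rankOneOp η η)
    rw [h0, map_zero, mul_rankOneOp] at h1
    have h3 := congrArg norm h1
    rw [norm_rankOneOp, hη, mul_one, norm_zero] at h3
    exact hη' (norm_eq_zero.1 h3.symm)
  set y := M.rsmul (rankOneOp η η) x' with hy_def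
  refine ⟨ξ, η, ((‖y‖⁻¹ : ℝ) : ℂ) • y, hξ, hη, ?_, ?_, ?_⟩
  · rw [norm_smul, Complex.norm_real, norm_inv, norm_norm,
      inv_mul_cancel₀ (norm_ne_zero_iff.2 hy)]
  · rw [map_smul, hy_def, M.lsmul_rsmul, hx'_def, ← M.mul_lsmul,
      rankOneOp_mul_rankOneOp_of_norm_one hξ]
  · rw [map_smul, hy_def, ← M.mul_rsmul, rankOneOp_mul_rankOneOp_of_norm_one hη]

variable {M} {ξ : H} {η : K} {x₀ : X}

namespace IsCornerUnit

/-- $\langle x_0,x_0\rangle$ is positive of norm one in the line $p\,\mathcal K(H)\,p=\mathbb Cp$.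
-/
theorem linner_self (h : M.IsCornerUnit ξ η x₀) : M.linner x₀ x₀ = rankOneOp ξ ξ := by
  refine eq_rankOneOp_of_smul h.norm_left ?_ ?_ (M.linner_self_nonneg x₀)
  · have h1 := M.linner_lsmul_lsmul (rankOneOp ξ ξ) (rankOneOp ξ ξ) x₀ x₀
    rw [h.lsmul_unit, star_rankOneOp] at h1
    exact h1.symm
  · rw [M.norm_linner_self, h.norm_unit, one_pow]

theorem rinner_self (h : M.IsCornerUnit ξ η x₀) : M.rinner x₀ x₀ = rankOneOp η η := by
  refine eq_rankOneOp_of_smul h.norm_right ?_ ?_ (M.rinner_self_nonneg x₀)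
  · have h1 := M.rinner_rsmul_rsmul (rankOneOp η η) (rankOneOp η η) x₀ x₀
    rw [h.rsmul_unit, star_rankOneOp] at h1
    exact h1.symm
  · rw [M.norm_rinner_self, h.norm_unit, one_pow]

/-- The corner is a line: $y=py=\langle x_0,x_0\rangle y=x_0\langle x_0,y\rangle$. As $x_0q=x_0$ and
$yq=y$, only $q\langle x_0,y\rangle q\in\mathbb Cq$ matters. -/
theorem exists_eq_smul (h : M.IsCornerUnit ξ η x₀) {y : X} (hl : M.lsmul (rankOneOp ξ ξ) y = y)
    (hr : M.rsmul (rankOneOp η η) y = y) : ∃ c : ℂ, y = c • x₀ := by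
  have h1 : y = M.rsmul (M.rinner x₀ y) x₀ := by
    rw [← M.linner_lsmul_eq_rinner_rsmul, h.linner_self, hl]
  refine ⟨inner ℂ η ((M.rinner x₀ y : K →L[ℂ] K) η), ?_⟩
  calc y = M.rsmul (rankOneOp η η * M.rinner x₀ y * rankOneOp η η) x₀ := by
        rw [M.mul_rsmul, M.mul_rsmul, h.rsmul_unit, ← h1, hr]
    _ = _ := by rw [rankOneOp_mul_mul_rankOneOp, map_smul, LinearMap.smul_apply, h.rsmul_unit]

theorem norm_rsmul (h : M.IsCornerUnit ξ η x₀) (k : K) : ‖M.rsmul (rankOneOp η k) x₀‖ = ‖k‖ := by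
  have h1 : ‖M.rsmul (rankOneOp η k) x₀‖ ^ 2 = ‖k‖ ^ 2 := by
    rw [← M.norm_rinner_self, M.rinner_rsmul_rsmul, h.rinner_self, star_rankOneOp,
      rankOneOp_mul_rankOneOp_of_norm_one h.norm_right,
      rankOneOp_mul_rankOneOp_of_norm_one h.norm_right, norm_rankOneOp, sq]
  exact (pow_left_inj₀ (norm_nonneg _) (norm_nonneg _) two_ne_zero).1 h1

/-- This isometric copy of $K$ in $X$ allows vectors $vk$ to be recovered from the bimodule: it
gives both the uniqueness and the strong continuity of $v$. -/
theorem isometry_rsmul (h : M.IsCornerUnit ξ η x₀) :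
    Isometry fun k => M.rsmul (rankOneOp η k) x₀ :=
  Isometry.of_dist_eq fun k k' => by
    rw [dist_eq_norm, dist_eq_norm, ← h.norm_rsmul (k - k'), rankOneOp_sub_right, map_sub,
      LinearMap.sub_apply]

end IsCornerUnit

variable (M ξ η x₀) in
/-- The vector `u x₀ v*`, where `x₀` is a unit vector of the corner determined by `ξ` and `η`. -/
noncomputable def translateUnit (u : H ≃ₗᵢ[ℂ] H) (v : K ≃ₗᵢ[ℂ] K) : X :=
  M.lsmul (rankOneOp (u ξ) ξ) (M.rsmul (rankOneOp η (v η)) x₀)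

theorem translateUnit_mul_scalar (u : H ≃ₗᵢ[ℂ] H) (v : K ≃ₗᵢ[ℂ] K) (z : Circle) :
    M.translateUnit ξ η x₀ u (v * scalarUnitary K z) =
      conj (z : ℂ) • M.translateUnit ξ η x₀ u v := by
  have h1 : (v * scalarUnitary K z) η = (z : ℂ) • v η := map_smul v (z : ℂ) η
  rw [translateUnit, h1, rankOneOp_smul_right, map_smul, LinearMap.smul_apply, map_smul]
  rfl

theorem IsCornerUnit.rsmul_translateUnit (h : M.IsCornerUnit ξ η x₀) (u : H ≃ₗᵢ[ℂ] H)
    (v : K ≃ₗᵢ[ℂ] K) (k : K) :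
    M.rsmul (rankOneOp (v η) k) (M.translateUnit ξ η x₀ u v) =
      M.lsmul (rankOneOp (u ξ) ξ) (M.rsmul (rankOneOp η k) x₀) := by
  rw [translateUnit, ← M.lsmul_rsmul, ← M.mul_rsmul,
    rankOneOp_mul_rankOneOp_of_norm_one (by rw [v.norm_map, h.norm_right])]

section Automorphism

variable {γ : X ≃ₗ[ℂ] X} {u : H ≃ₗᵢ[ℂ] H} {v : K ≃ₗᵢ[ℂ] K}

/-- $\gamma(x_0)$ lies in the corner of $u\xi$ and $v\eta$, a line spanned by $ux_0v^*$. The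
proportionality factor $c$ has modulus one and is absorbed by replacing $v$ with $\bar c\,v$. -/
theorem IsCornerUnit.exists_translateUnit_eq (h : M.IsCornerUnit ξ η x₀)
    (hl : ∀ T x, γ (M.lsmul T x) = M.lsmul (Ad H u T) (γ x))
    (hr : ∀ T x, γ (M.rsmul T x) = M.rsmul (Ad K v T) (γ x))
    (hli : ∀ x y, M.linner (γ x) (γ y) = Ad H u (M.linner x y)) :
    ∃ z : Circle, γ x₀ = M.translateUnit ξ η x₀ u (v * scalarUnitary K z) := by
  have hnorm : ‖γ x₀‖ = 1 := by
    have h1 : ‖γ x₀‖ ^ 2 = 1 ^ 2 := by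
      rw [← M.norm_linner_self, hli, norm_Ad_apply, M.norm_linner_self, h.norm_unit]
    exact (pow_left_inj₀ (norm_nonneg _) zero_le_one two_ne_zero).1 h1
  have hγl : M.lsmul (rankOneOp (u ξ) (u ξ)) (γ x₀) = γ x₀ := by
    rw [← Ad_rankOneOp, ← hl, h.lsmul_unit]
  have hγr : M.rsmul (rankOneOp (v η) (v η)) (γ x₀) = γ x₀ := by
    rw [← Ad_rankOneOp, ← hr, h.rsmul_unit]
  -- $\gamma(x_0)$ carried back to the corner of $x_0$, heuristically $u^*\gamma(x_0)v$.
  let y : X := M.lsmul (rankOneOp ξ (u ξ)) (M.rsmul (rankOneOp (v η) η) (γ x₀))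
  obtain ⟨c, hc⟩ : ∃ c : ℂ, y = c • x₀ := by
    refine h.exists_eq_smul ?_ ?_
    · rw [← M.mul_lsmul, rankOneOp_mul_rankOneOp_of_norm_one h.norm_left]
    · rw [← M.lsmul_rsmul, ← M.mul_rsmul, rankOneOp_mul_rankOneOp_of_norm_one h.norm_right]
  have h1 : γ x₀ = c • M.translateUnit ξ η x₀ u v := by
    have h2 : M.lsmul (rankOneOp (u ξ) ξ) (M.rsmul (rankOneOp η (v η)) y) = γ x₀ := by
      rw [← M.lsmul_rsmul, ← M.mul_lsmul, ← M.mul_rsmul,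
        rankOneOp_mul_rankOneOp_of_norm_one h.norm_left,
        rankOneOp_mul_rankOneOp_of_norm_one h.norm_right, hγr, hγl]
    rw [← h2, hc, map_smul, map_smul]
    rfl
  have hrank : ∀ (w : H ≃ₗᵢ[ℂ] H), ‖rankOneOp (w ξ) ξ‖ = 1 := fun w => by
    rw [norm_rankOneOp, w.norm_map, h.norm_left, mul_one]
  have hc1 : ‖c‖ = 1 := by
    refine le_antisymm ?_ ?_
    · calc ‖c‖ = ‖y‖ := by rw [hc, norm_smul, h.norm_unit, mul_one]
        _ ≤ ‖rankOneOp ξ (u ξ)‖ * (‖rankOneOp (v η) η‖ * ‖γ x₀‖) :=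
          (M.norm_lsmul_le _ _).trans
            (mul_le_mul_of_nonneg_left (M.norm_rsmul_le _ _) (norm_nonneg _))
        _ = 1 := by
          rw [norm_rankOneOp, norm_rankOneOp, u.norm_map, v.norm_map, h.norm_left, h.norm_right,
            hnorm]
          norm_num
    · have h3 : ‖M.translateUnit ξ η x₀ u v‖ ≤ 1 := by
        refine (M.norm_lsmul_le _ _).trans_eq ?_
        rw [h.norm_rsmul, norm_rankOneOp, u.norm_map, v.norm_map, h.norm_left, h.norm_right]
        norm_num
      rw [← hnorm, h1, norm_smul]
      exact mul_le_of_le_one_right (norm_nonneg _) h3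
  let z : Circle := ⟨conj c, by simpa [Submonoid.unitSphere] using hc1⟩
  refine ⟨z, ?_⟩
  rw [translateUnit_mul_scalar, h1]
  change _ = conj (conj c) • _
  rw [Complex.conj_conj]

/-- If the linear bijection `γ` of `X` is compatible with `Ad u` and `Ad v` and maps `x₀` to
`u x₀ v*`, then `v` is determined by `γ` and `u`. -/
theorem IsCornerUnit.rsmul_apply (h : M.IsCornerUnit ξ η x₀)
    (hr : ∀ T x, γ (M.rsmul T x) = M.rsmul (Ad K v T) (γ x))
    (hγ : γ x₀ = M.translateUnit ξ η x₀ u v) (k : K) :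
    M.rsmul (rankOneOp η (v k)) x₀ =
      M.lsmul (rankOneOp ξ (u ξ)) (γ (M.rsmul (rankOneOp η k) x₀)) := by
  -- $\gamma(x_0|\eta\rangle\langle k|)=ux_0v^*\,|v\eta\rangle\langle vk|=u\,x_0|\eta\rangle\langle
  -- vk|$, and $|\xi\rangle\langle u\xi|$ then removes $u$.
  rw [hr, Ad_rankOneOp, hγ, h.rsmul_translateUnit, ← M.mul_lsmul,
    rankOneOp_mul_rankOneOp_of_norm_one (by rw [u.norm_map, h.norm_left]), M.lsmul_rsmul,
    h.lsmul_unit]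

/-- This is the source of multiplicativity: if $\gamma_{g'}(x_0)=u'x_0v'^*$, then
$\gamma_{gg'}(x_0)=(uu')x_0(vv')^*$. -/
theorem IsCornerUnit.apply_translateUnit (h : M.IsCornerUnit ξ η x₀)
    (hl : ∀ T x, γ (M.lsmul T x) = M.lsmul (Ad H u T) (γ x))
    (hr : ∀ T x, γ (M.rsmul T x) = M.rsmul (Ad K v T) (γ x))
    (hγ : γ x₀ = M.translateUnit ξ η x₀ u v) (u' : H ≃ₗᵢ[ℂ] H) (v' : K ≃ₗᵢ[ℂ] K) :
    γ (M.translateUnit ξ η x₀ u' v') = M.translateUnit ξ η x₀ (u * u') (v * v') := by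
  rw [translateUnit, hl, hr, hγ, Ad_rankOneOp, Ad_rankOneOp, h.rsmul_translateUnit, ← M.mul_lsmul,
    rankOneOp_mul_rankOneOp_of_norm_one (by rw [u.norm_map, h.norm_left])]
  rfl

theorem IsCornerUnit.unitary_eq (h : M.IsCornerUnit ξ η x₀) {v' : K ≃ₗᵢ[ℂ] K}
    (hr : ∀ T x, γ (M.rsmul T x) = M.rsmul (Ad K v T) (γ x))
    (hr' : ∀ T x, γ (M.rsmul T x) = M.rsmul (Ad K v' T) (γ x))
    (hγ : γ x₀ = M.translateUnit ξ η x₀ u v) (hγ' : γ x₀ = M.translateUnit ξ η x₀ u v') :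
    v = v' :=
  LinearIsometryEquiv.ext fun k => h.isometry_rsmul.injective
    ((h.rsmul_apply hr hγ k).trans (h.rsmul_apply hr' hγ' k).symm)

end Automorphism

end EquivalenceBimodule

end Corner

/-! ### From Morita equivalent actions to equivalent twists -/

section EquivalentOfMorita

variable {G : Type u} [Group G] [TopologicalSpace G] [IsTopologicalGroup G]
  [LocallyCompactSpace G] [T2Space G]

/-- The isomorphism sends $(g,u)$ to the unique $(g,v)\in G_\beta$ with $\gamma_g(x_0)=ux_0v^*$.
Uniqueness makes it a homomorphism compatible with $\mathbb T$. -/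
theorem twist_equivalent_of_moritaEquivalent {a b : CompactAction G} (hab : MoritaEquivalent a b) :
    a.twist.Equivalent b.twist := by
  obtain ⟨X, _, _, _, M, γ, hc, hl, hr, hli, -⟩ := hab
  have := b.isAction.nontrivial
  obtain ⟨ξ, η, x₀, h⟩ := M.exists_isCornerUnit
  have hl' : ∀ p : a.twist.carrier, ∀ T x,
      γ p.1.1 (M.lsmul T x) = M.lsmul (Ad a.H p.1.2 T) (γ p.1.1 x) := fun p T x =>
    (hl p.1.1 T x).trans (congrArg (fun S => M.lsmul S (γ p.1.1 x))
      (DFunLike.congr_fun (show a.α p.1.1 = Ad a.H p.1.2 from p.2) T))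
  have hr' : ∀ (g : G) (s : b.twist.carrier), s.1.1 = g → ∀ T x,
      γ g (M.rsmul T x) = M.rsmul (Ad b.H s.1.2 T) (γ g x) := by
    rintro _ s rfl T x
    exact (hr s.1.1 T x).trans (congrArg (fun S => M.rsmul S (γ s.1.1 x))
      (DFunLike.congr_fun (show b.α s.1.1 = Ad b.H s.1.2 from s.2) T))
  have hex : ∀ p : a.twist.carrier, ∃ s : b.twist.carrier, s.1.1 = p.1.1 ∧
      γ p.1.1 x₀ = M.translateUnit ξ η x₀ p.1.2 s.1.2 := fun p => by
    obtain ⟨s, hs⟩ := b.twist.isTwist.isOpenQuotientMap_q.surjective p.1.1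
    have hs' : s.1.1 = p.1.1 := hs
    obtain ⟨z, hz⟩ := h.exists_translateUnit_eq (γ := γ p.1.1) (u := p.1.2) (v := s.1.2) (hl' p)
      (hr' _ s hs') fun x y =>
        (hli p.1.1 x y).trans
          (DFunLike.congr_fun (show a.α p.1.1 = Ad a.H p.1.2 from p.2) (M.linner x y))
    -- An arbitrary lift `s` of $g$ to $G_\beta$ is corrected by a phase.
    refine ⟨s * b.twist.ι z, ?_, hz⟩
    rw [← hs']
    exact mul_one s.1.1
  choose f hf1 hf2 using hex
  have huniq : ∀ p s, s.1.1 = p.1.1 → γ p.1.1 x₀ = M.translateUnit ξ η x₀ p.1.2 s.1.2 →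
      f p = s := fun p s hs1 hs2 => by
    refine Subtype.ext (Prod.ext ((hf1 p).trans hs1.symm) (h.unitary_eq
      (hr' _ (f p) (hf1 p)) (hr' _ s hs1) (hf2 p) hs2))
  have hone : M.translateUnit ξ η x₀ 1 1 = x₀ := by
    change M.lsmul (rankOneOp ξ ξ) (M.rsmul (rankOneOp η η) x₀) = x₀
    rw [h.rsmul_unit, h.lsmul_unit]
  let φ : a.twist.carrier →* b.twist.carrier :=
    { toFun := f
      map_one' := huniq 1 1 rfl (by
        change γ 1 x₀ = M.translateUnit ξ η x₀ 1 1
        rw [map_one, hone]; rfl)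
      map_mul' := fun p p' => huniq (p * p') (f p * f p')
        (congrArg₂ (· * ·) (hf1 p) (hf1 p')) (by
          change γ (p.1.1 * p'.1.1) x₀ =
            M.translateUnit ξ η x₀ (p.1.2 * p'.1.2) ((f p).1.2 * (f p').1.2)
          rw [map_mul, LinearEquiv.mul_apply, hf2 p']
          exact h.apply_translateUnit (hl' p) (hr' _ (f p) (hf1 p)) (hf2 p) _ _) }
  refine Twist.equivalent_of_continuous φ (b.continuous_extension_iff.2 ⟨?_, fun k => ?_⟩)
    (fun z => huniq _ _ rfl ?_) hf1
  · exact a.continuous_extension_fst.congr fun p => (hf1 p).symm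
  · rw [h.isometry_rsmul.isEmbedding.continuous_iff]
    have h1 : ∀ p, M.rsmul (rankOneOp η ((f p).1.2 k)) x₀ =
        M.lsmul (rankOneOp ξ (p.1.2 ξ)) (γ p.1.1 (M.rsmul (rankOneOp η k) x₀)) := fun p =>
      h.rsmul_apply (hr' _ (f p) (hf1 p)) (hf2 p) k
    refine Continuous.congr ?_ fun p => (h1 p).symm
    exact M.continuous_lsmul.comp
      ((continuous_rankOneOp.comp (continuous_const.prodMk (a.continuous_extension_snd ξ))).prodMk
        ((hc _).comp a.continuous_extension_fst))
  · change γ 1 x₀ = M.lsmul (rankOneOp ((z : ℂ) • ξ) ξ) (M.rsmul (rankOneOp η ((z : ℂ) • η)) x₀)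
    have hz : (z : ℂ) * conj (z : ℂ) = 1 := by
      rw [Complex.mul_conj, Circle.normSq_coe]; simp
    rw [rankOneOp_smul_left, rankOneOp_smul_right, map_smul, map_smul, LinearMap.smul_apply,
      LinearMap.smul_apply, map_smul, h.rsmul_unit, h.lsmul_unit, smul_smul, hz, one_smul, map_one]
    rfl

end EquivalentOfMorita

/-! ### The classification -/

section Classification

variable {G : Type u} [Group G] [TopologicalSpace G] [IsTopologicalGroup G]
  [LocallyCompactSpace G] [T2Space G]

theorem moritaEquivalent_iff {a b : CompactAction G} :
    MoritaEquivalent a b ↔ TwistClass.mk a.twist = TwistClass.mk b.twist :=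
  ⟨fun h => Quotient.sound (twist_equivalent_of_moritaEquivalent h),
    fun h => moritaEquivalent_of_twist_equivalent (Quotient.exact h)⟩

/-- Morita equivalence is equality of an invariant, so no dual bimodules or tensor products are
needed. -/
theorem equivalence_moritaEquivalent : Equivalence (MoritaEquivalent (G := G)) where
  refl _ := moritaEquivalent_iff.2 rfl
  symm h := moritaEquivalent_iff.2 (moritaEquivalent_iff.1 h).symm
  trans h h' := moritaEquivalent_iff.2
    ((moritaEquivalent_iff.1 h).trans (moritaEquivalent_iff.1 h'))

variable [MeasurableSpace G] [BorelSpace G] (μ : Measure G) [μ.IsHaarMeasure]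

/-- The bijection `Br(G) ≃ Twist(G)`, `[α] ↦ [G_α]`. -/
noncomputable def brauerEquivTwist : BrauerClass G ≃ TwistClass G :=
  Equiv.ofBijective
    (Quot.lift (fun a : CompactAction G => TwistClass.mk a.twist) fun _ _ h =>
      moritaEquivalent_iff.1 h)
    ⟨by
      rintro ⟨a⟩ ⟨b⟩ h
      exact Quot.sound (moritaEquivalent_iff.2 h),
    by
      rintro ⟨E⟩
      exact ⟨BrauerClass.mk (regularAction μ E),
        (Quotient.sound (E.equivalent_twist_regularAction μ)).symm⟩⟩

theorem brauerEquivTwist_mk (a : CompactAction G) :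
    brauerEquivTwist μ (BrauerClass.mk a) = TwistClass.mk a.twist := rfl

end Classification

end GroupTwist

theorem proposition4p3 (G : Type u) [Group G] [TopologicalSpace G] [IsTopologicalGroup G]
    [LocallyCompactSpace G] [T2Space G] [MeasurableSpace G] [BorelSpace G]
    (μ : MeasureTheory.Measure G) [μ.IsHaarMeasure] :
    Equivalence (GroupTwist.MoritaEquivalent (G := G)) ∧
    ∃ (hρ : ∀ E : GroupTwist.Twist G, (GroupTwist.regularHom μ E).IsAction)
      (hE : ∀ a : GroupTwist.CompactAction G, a.extension.IsTwist)
      (Φ : GroupTwist.TwistClass G ≃ GroupTwist.BrauerClass G),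
      (∀ E : GroupTwist.Twist G,
        Φ (GroupTwist.TwistClass.mk E) =
          GroupTwist.BrauerClass.mk ⟨GroupTwist.regularHom μ E, hρ E⟩) ∧
      ∀ a : GroupTwist.CompactAction G,
        Φ.symm (GroupTwist.BrauerClass.mk a) = GroupTwist.TwistClass.mk ⟨a.extension, hE a⟩ := by
  refine ⟨GroupTwist.equivalence_moritaEquivalent, GroupTwist.regularHom_isAction μ,
    fun a => a.isAction.isTwist_extension, (GroupTwist.brauerEquivTwist μ).symm, fun E => ?_,
    fun a => GroupTwist.brauerEquivTwist_mk μ a⟩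
  -- As the bijection is defined as the inverse of $[\alpha]\mapsto[G_\alpha]$, the claim becomes
  -- $\tilde G\cong G_{\tilde\alpha}$.
  rw [Equiv.symm_apply_eq]
  exact Quotient.sound (E.equivalent_twist_regularAction μ)
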